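/- **Setting.** Let $n\ge 1$, $d_1,\dots,d_n\ge 1$, $\bar n=\sum_i d_i$, and let $\mathcal K=\mathcal K_1\times\dots\times\mathcal K_n\subset\mathbb R^{\bar n}$ with $\mathcal K_i=\{(x_{i0};x_{i1})\in\mathbb R\times\mathbb R^{d_i-1}:\|x_{i1}\|\le x_{i0}\}$ (a half-line if $d_i=1$, a second-order cone if $d_i\ge 2$). Write $x\succeq 0$ for $x\in\mathcal K$ and $x\succ 0$ for $x\in\operatorname{int}\mathcal K$. Let $e=(e_1;\dots;e_n)$ with $e_i=(1;0)$, $\lambda_{\min}(x)=\min_i(x_{i0}-\|x_{i1}\|)$ and $\mathcal C(w,v)=\{x\in\mathcal K_i: w^Tx\le w^Tv\}$ for vectors $w,v$ of block $i$. Let $A\in\mathbb R^{m\times\bar n}$ have linearly independent rows, let $\varepsilon>0$, let $\mathcal F=\{x: Ax=0,\ \|x\|_\infty\le 1,\ x\succeq 0\}$, and let $\mathcal F_i$ be the projection of $\mathcal F$ onto block $i$. **Basic procedure** (input: a matrix $B$ with $\bar n$ columns and linearly independent rows, and $y\succ0$ with $e^Ty=1$). Compute the orthogonal projection $P$ onto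 $\operatorname{Ker}B$ and $z=Py$. Repeat: (1) if $z=0$, return the dual solution $y$; if $z\succ0$, return the primal solution $z$; if $2\sqrt n\,\|z\|\le y_{k0}$ for some $k$, return $y$ with any such $k$ (a cut). (2) Otherwise choose any $i$ with $z_i\notin\operatorname{int}\mathcal K_i$; let $\eta$ be zero outside block $i$, with $\eta_i=e_i$ if $z_{i0}\le 0$, and $\eta_i=e_i-(\hat z_i-e_i)/\|\hat z_i-e_i\|$, $\hat z_i=z_i/z_{i0}$, if $z_{i0}>0$. Let $p=P\eta$; if $p=0$, return the dual solution $\eta$; if $p\succ0$, return the primal solution $p$. (3) Otherwise let $\alpha=p^T(p-z)/\|z-p\|^2$ and replace $(y,z)$ by $(\alpha y+(1-\alpha)\eta,\ \alpha z+(1-\alpha)p)$. **Main algorithm** (input $A$, $\varepsilon$). Start with $M=I$ (block diagonal, with blocks $M_i$) and $v_i=1$ for all $i$. Repeat: call the basic procedure with the matrix $AM$ and the vector $e/n$. If it returns a primal solution $\tilde x$, return $x=M\tilde x$. If it returns a dual solution $\tilde y$, return $s=M^{-T}\tilde y$. If it returns a cut $(y,k)$, let $\eta=\|y_{k1}\|/y_{k0}$;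 take $w=y_k$, $v=e_k/\sqrt2$ if $\eta\le0.6$, and $w=(1;\kappa y_{k1}/y_{k0})$, $v=(1;-\kappa y_{k1}/y_{k0})$ with $\kappa=\eta^{-2}(1-1/\sqrt2)$ if $\eta>0.6$. With $(\alpha;\beta)=w/\sqrt{w_0^2-\|w_1\|^2}$ let $$G=\big((\alpha;\beta)^Tv\big)\begin{pmatrix}\alpha&-\beta^T\\-\beta&I+\frac{\beta\beta^T}{1+\alpha}\end{pmatrix}$$ (so $G=1/\sqrt2$ if $d_k=1$), replace $M_k$ by $M_kG$ and $v_k$ by $\det(G)\,v_k$, and if now $v_k\le\varepsilon^{d_k}$, stop and declare "no $\varepsilon$-interior feasible solution". The algorithms run in exact real arithmetic; additions, subtractions, multiplications, divisions, square roots, comparisons and the loading of integer constants count as one arithmetic operation each. Standard linear algebra is used: $P$ is computed by $m$ successive rank-one projection updates, and products with $G$ and $G^{-1}$ use the structure of these matrices. **Theorem.** There is an absolute constant $C>0$ such that for all such $n$, $d_i$, $m$, $A$, $\varepsilon$, and for every way of making the unspecified choices of indices, the main algorithm performs no illegal operation (division by zero, root of a negative number, choice from an empty set), and it terminates after at most $$C\,n\,\max\{1,\log\varepsilon^{-1}\}$$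 calls of the basic procedure and at most $$C\,n\,\big(n^3\,\bar n\,\max_i d_i+m\,\bar n^2\big)\max\{1,\log\varepsilon^{-1}\}$$ arithmetic operations, that is, $O(n\log\varepsilon^{-1})$ calls and $O\big(n(n^3\bar n\max_i d_i+m\bar n^2)\log\varepsilon^{-1}\big)$ operations for small $\varepsilon$. On termination it * returns $x$ with $Ax=0$, $x\succ0$; or * returns $s\ne0$ with $s\succeq0$ and $s=-A^Tu$ for some $u\in\mathbb R^m$; or * declares "no $\varepsilon$-interior feasible solution", and then there is no $x$ with $Ax=0$, $\|x\|_\infty\le1$ and $\lambda_{\min}(x)\ge\varepsilon$. Moreover, at the start, and after every cut made in the course of the algorithm, for every $i$ the region $M_i\,\mathcal C(e_i,e_i)$ contains $\mathcal F_i$ and is of the form $\mathcal C(w,v)$ with $w,v\in\operatorname{int}\mathcal K_i$. Every cut of block $k$ leaves the regions of the other blocks unchanged and multiplies the volume of the region of block $k$ by a factor of at most $0.96^{d_k}$. -/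

import Mathlib

/-! ## A real-number machine with an operation count

`Prog S α` is the type of programs that compute with scalars from `S` and return a value of
type `α`.  The algorithms below are written for an arbitrary scalar type `S`, so the only way in
which they can combine or inspect scalars is through the primitive instructions of `Prog`, all of
which are charged for. -/

inductive Prog (S : Type) : Type → Type 1
  | ret {α : Type} (a : α) : Prog S α
  | bind {α β : Type} (p : Prog S α) (f : α → Prog S β) : Prog S β
  | lit (k : ℕ) : Prog S S
  | add (a b : S) : Prog S S
  | sub (a b : S) : Prog S S
  | mul (a b : S) : Prog S S
  | div (a b : S) : Prog S S
  | sqrt (a : S) : Prog S S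
  /-- comparison `a ≤ b` -/
  | le (a b : S) : Prog S Bool
  /-- an arbitrary, unspecified choice of a member of `l` -/
  | choose {α : Type} (l : List α) : Prog S α
  /-- run the subroutine `p`; such calls are counted -/
  | call {α : Type} (p : Prog S α) : Prog S α
  /-- repeat `body` until it returns `Sum.inr a`, then return `a` -/
  | loop {σ α : Type} (body : σ → Prog S (σ ⊕ α)) (s : σ) : Prog S α

namespace Prog

instance instMonadProg (S : Type) : Monad (Prog S) where
  pure := Prog.ret
  bind := Prog.bind

/-- `(c.1, c.2)`: the number of arithmetic operations and the number of counted calls. -/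
abbrev Cost : Type := ℕ × ℕ

/-- Finite executions of a loop whose body has the executions `R`. -/
inductive LoopRuns {σ α : Type} (R : σ → (σ ⊕ α) → Cost → Prop) : σ → α → Cost → Prop
  | done {s : σ} {a : α} {c : Cost} (h : R s (Sum.inr a) c) : LoopRuns R s a c
  | more {s s' : σ} {a : α} {c c' : Cost} (h : R s (Sum.inl s') c) (h' : LoopRuns R s' a c') :
      LoopRuns R s a (c + c')

/-- Every execution of a loop is finite and legal, if the body has the executions `R` and `H s`
says that every execution of the body from `s` is finite and legal. -/
inductive LoopHalts {σ α : Type} (R : σ → (σ ⊕ α) → Cost → Prop) (H : σ → Prop) : σ → Prop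
  | intro {s : σ} (h : H s) (h' : ∀ s' c, R s (Sum.inl s') c → LoopHalts R H s') :
      LoopHalts R H s

/-- `p.Runs a c`: over exact real numbers, some execution of `p` halts with value `a` at cost `c`.
Each of the instructions `lit`, `add`, `sub`, `mul`, `div`, `sqrt`, `le` costs one arithmetic
operation. -/
def Runs : {α : Type} → Prog ℝ α → α → Cost → Prop
  | _, .ret a, x, c => x = a ∧ c = (0, 0)
  | _, .bind p f, x, c => ∃ a c₁ c₂, Runs p a c₁ ∧ Runs (f a) x c₂ ∧ c = c₁ + c₂
  | _, .lit k, x, c => x = (k : ℝ) ∧ c = (1, 0)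
  | _, .add a b, x, c => x = a + b ∧ c = (1, 0)
  | _, .sub a b, x, c => x = a - b ∧ c = (1, 0)
  | _, .mul a b, x, c => x = a * b ∧ c = (1, 0)
  | _, .div a b, x, c => b ≠ 0 ∧ x = a / b ∧ c = (1, 0)
  | _, .sqrt a, x, c => 0 ≤ a ∧ x = Real.sqrt a ∧ c = (1, 0)
  | _, .le a b, x, c => (x = true ↔ a ≤ b) ∧ c = (1, 0)
  | _, .choose l, x, c => x ∈ l ∧ c = (0, 0)
  | _, .call p, x, c => ∃ c', Runs p x c' ∧ c = c' + (0, 1)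
  | _, .loop body s, x, c => LoopRuns (fun s' => Runs (body s')) s x c

/-- Every execution of `p`, whatever choices are made, halts after finitely many steps, never
divides by zero, never takes the root of a negative number, never chooses from an empty list. -/
def Halts : {α : Type} → Prog ℝ α → Prop
  | _, .bind p f => Halts p ∧ ∀ a c, Runs p a c → Halts (f a)
  | _, .div _ b => b ≠ 0
  | _, .sqrt a => 0 ≤ a
  | _, .choose l => l ≠ []
  | _, .call p => Halts p
  | _, .loop body s => LoopHalts (fun s' => Runs (body s')) (fun s' => Halts (body s')) s
  | _, _ => True

/-! ### Bounded loops and elementary vector operations -/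

variable {S ι : Type}

/-- `for i in l do b := f i b` -/
def iter {β : Type} : List ι → (ι → β → Prog S β) → β → Prog S β
  | [], _, b => .ret b
  | i :: l, f, b => do
      let b' ← f i b
      iter l f b'

/-- `∑ i ∈ l, f i` -/
def sumOver (l : List ι) (f : ι → Prog S S) : Prog S S := do
  let zero ← .lit 0
  iter l (fun i acc => do
    let x ← f i
    .add acc x) zero

/-- Overwrite the entries `v i`, `i ∈ l`, of the array `v` by the values of `f i`. -/
def fill {β : Type} [DecidableEq ι] (v : ι → β) (l : List ι) (f : ι → Prog S β) :
    Prog S (ι → β) :=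
  iter l (fun i w => do
    let x ← f i
    .ret (Function.update w i x)) v

/-- The sublist of those `i ∈ l` that pass the test. -/
def select : List ι → (ι → Prog S Bool) → Prog S (List ι)
  | [], _ => .ret []
  | i :: l, test => do
      let b ← test i
      let l' ← select l test
      .ret (if b then i :: l' else l')

/-- `∑ i ∈ l, x i * y i` -/
def dot (l : List ι) (x y : ι → S) : Prog S S := sumOver l (fun i => .mul (x i) (y i))

/-- `acc * a ^ k` -/
def mulPow (acc a : S) (k : ℕ) : Prog S S := iter (List.range k) (fun _ b => .mul b a) acc

end Prog

/-! ## Products of second-order cones and half-lines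

There are `n` blocks; block `i` has dimension `d i = r i + 1 ≥ 1`, its coordinate `0` is the axis
of the cone and the coordinates `a.succ`, `a : Fin (r i)`, are the rotational part. -/

/-- Coordinates of `ℝ^{d 1} × ⋯ × ℝ^{d n}`. -/
abbrev Idx {n : ℕ} (r : Fin n → ℕ) : Type := (i : Fin n) × Fin (r i + 1)

/-- Block `i` of a vector. -/
def blk {n : ℕ} {r : Fin n → ℕ} {S : Type} (x : Idx r → S) (i : Fin n) : Fin (r i + 1) → S :=
  fun a => x ⟨i, a⟩

/-- The vector `x` with block `k` replaced by `b`. -/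
def setBlk {n : ℕ} {r : Fin n → ℕ} {S : Type} (x : Idx r → S) (k : Fin n)
    (b : Fin (r k + 1) → S) : Idx r → S :=
  fun q => Function.update (fun i => blk x i) k b q.1 q.2

/-- `Idx r` as a list. -/
def idxList {n : ℕ} (r : Fin n → ℕ) : List (Idx r) :=
  (List.finRange n).sigma (fun i => List.finRange (r i + 1))

/-- Euclidean norm of the rotational part of a block. -/
noncomputable def tailNorm {p : ℕ} (x : Fin (p + 1) → ℝ) : ℝ :=
  Real.sqrt (∑ a : Fin p, x a.succ ^ 2)

/-- The cone `{(x₀; x₁) | ‖x₁‖ ≤ x₀}` of dimension `p + 1`: the half-line `x₀ ≥ 0` if `p = 0`, the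
second-order cone if `p ≥ 1`. -/
def soc (p : ℕ) : Set (Fin (p + 1) → ℝ) := {x | tailNorm x ≤ x 0}

/-- The product cone `𝒦`. -/
def prodCone {n : ℕ} (r : Fin n → ℕ) : Set (Idx r → ℝ) := {x | ∀ i, blk x i ∈ soc (r i)}

/-- The minimum eigenvalue `min_i (x_{i0} - ‖x_{i1}‖)`. -/
noncomputable def lambdaMin {n : ℕ} {r : Fin n → ℕ} (x : Idx r → ℝ) : ℝ :=
  ⨅ i, (blk x i 0 - tailNorm (blk x i))

/-- `ℱ`: solutions of `A x = 0`, `‖x‖_∞ ≤ 1`, `x ⪰ 0` (the norm of a function type is the maximum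
norm). -/
def feasibleSet {n m : ℕ} {r : Fin n → ℕ} (A : Matrix (Fin m) (Idx r) ℝ) : Set (Idx r → ℝ) :=
  {x | A.mulVec x = 0 ∧ ‖x‖ ≤ 1 ∧ x ∈ prodCone r}

/-- The projection of `ℱ` onto block `i`. -/
def feasibleBlk {n m : ℕ} {r : Fin n → ℕ} (A : Matrix (Fin m) (Idx r) ℝ) (i : Fin n) :
    Set (Fin (r i + 1) → ℝ) :=
  (fun x => blk x i) '' feasibleSet A

/-- The truncated cone `𝒞(w, v) = {x ∈ 𝒦 | wᵀ x ≤ wᵀ v}`. -/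
def truncCone {p : ℕ} (w v : Fin (p + 1) → ℝ) : Set (Fin (p + 1) → ℝ) :=
  {x | x ∈ soc p ∧ w ⬝ᵥ x ≤ w ⬝ᵥ v}

/-- The axis vector `e = (1; 0)` of a block. -/
def axis (p : ℕ) : Fin (p + 1) → ℝ := Pi.single 0 1

/-! ## The basic procedure -/

section Algorithm

open Prog

variable {S : Type} {n m : ℕ} {r : Fin n → ℕ}

/-- The squared norm of the rotational part of a block. -/
def tailSq {p : ℕ} (x : Fin (p + 1) → S) : Prog S S :=
  dot (List.finRange p) (fun a => x a.succ) (fun a => x a.succ)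

/-- The blocks of `z` that are not in the interior of their cones, that is,
`z_{i0} ≤ ‖z_{i1}‖`. -/
def badBlocks (z : Idx r → S) : Prog S (List (Fin n)) :=
  select (List.finRange n) (fun i => do
    let q ← tailSq (blk z i)
    let t ← .sqrt q
    .le (blk z i 0) t)

/-- The orthogonal projection matrix onto `Ker A`, for `A` with linearly independent rows.
Starting with `P = I`, every row `a` of `A` replaces `P` by `P - v vᵀ / (vᵀ v)`, `v = P a`. -/
def projection (A : Fin m → Idx r → S) : Prog S (Idx r → Idx r → S) := do
  let zero ← .lit 0
  let one ← .lit 1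
  iter (List.finRange m) (fun j P => do
    let v ← fill (fun _ => zero) (idxList r) (fun q => dot (idxList r) (P q) (A j))
    let s ← dot (idxList r) v v
    fill P (idxList r) (fun q => fill (P q) (idxList r) (fun q' => do
      let t ← .mul (v q) (v q')
      let t' ← .div t s
      .sub (P q q') t'))) (fun q q' => if q = q' then one else zero)

/-- For a block `z_i` outside the interior of the cone: a vector `η_i` of the cone with
`η_{i0} = 1` and `η_iᵀ z_i ≤ 0`, namely `e_i` if `z_{i0} ≤ 0`, and otherwise
`e_i - (ẑ - e_i) / ‖ẑ - e_i‖` with `ẑ = z_i / z_{i0}`. -/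
def separator {p : ℕ} (z : Fin (p + 1) → S) : Prog S (Fin (p + 1) → S) := do
  let zero ← .lit 0
  let one ← .lit 1
  let b ← .le (z 0) zero
  if b then
    .ret (Fin.cons one (fun _ => zero))
  else do
    let u ← fill (fun _ => zero) (List.finRange p) (fun a => .div (z a.succ) (z 0))
    let q ← dot (List.finRange p) u u
    let t ← .sqrt q
    let w ← fill (fun _ => zero) (List.finRange p) (fun a => do
      let x ← .div (u a) t
      .sub zero x)
    .ret (Fin.cons one w)

/-- Outcomes of the basic procedure. -/
inductive BPOut (S : Type) {n : ℕ} (r : Fin n → ℕ) : Type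
  | primal (x : Idx r → S)
  | dual (y : Idx r → S)
  | cut (y : Idx r → S) (k : Fin n)

/-- One iteration of the basic procedure with current iterate `y` and `z = P y`. -/
def bpBody (P : Idx r → Idx r → S) (yz : (Idx r → S) × (Idx r → S)) :
    Prog S (((Idx r → S) × (Idx r → S)) ⊕ BPOut S r) := do
  let y := yz.1
  let z := yz.2
  let zero ← .lit 0
  let one ← .lit 1
  let zz ← dot (idxList r) z z
  let zIsZero ← .le zz zero
  if zIsZero then
    .ret (Sum.inr (.dual y))
  else do
    let bad ← badBlocks z
    if bad.isEmpty then
      .ret (Sum.inr (.primal z))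
    else do
      let two ← .lit 2
      let nn ← .lit n
      let rn ← .sqrt nn
      let rz ← .sqrt zz
      let t ← .mul two rn
      let t' ← .mul t rz
      let cuts ← select (List.finRange n) (fun k => .le t' (blk y k 0))
      if cuts.isEmpty then do
        let i ← .choose bad
        let ηi ← separator (blk z i)
        let η : Idx r → S := setBlk (fun _ => zero) i ηi
        let p ← fill (fun _ => zero) (idxList r)
          (fun q => dot (List.finRange (r i + 1)) (fun a => P q ⟨i, a⟩) ηi)
        let pp ← dot (idxList r) p p
        let pIsZero ← .le pp zero
        if pIsZero then
          .ret (Sum.inr (.dual η))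
        else do
          let bad' ← badBlocks p
          if bad'.isEmpty then
            .ret (Sum.inr (.primal p))
          else do
            let w ← fill (fun _ => zero) (idxList r) (fun q => .sub (p q) (z q))
            let num ← dot (idxList r) p w
            let den ← dot (idxList r) w w
            let α ← .div num den
            let α' ← .sub one α
            let comb := fun (x x' : Idx r → S) =>
              fill (fun _ => zero) (idxList r) (fun q => do
                let b ← Prog.mul α (x q)
                let b' ← Prog.mul α' (x' q)
                Prog.add b b')
            let y' ← comb y η
            let z' ← comb z p
            .ret (Sum.inl (y', z'))
      else do
        let k ← .choose cuts
        .ret (Sum.inr (.cut y k))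

/-- The basic procedure for the matrix `A`, started at `y`. -/
def basicProcedure (A : Fin m → Idx r → S) (y : Idx r → S) : Prog S (BPOut S r) := do
  let P ← projection A
  let zero ← .lit 0
  let z ← fill (fun _ => zero) (idxList r) (fun q => dot (idxList r) (P q) y)
  .loop (bpBody P) (y, z)

/-! ## The main algorithm -/

/-- The vectors `w`, `v` of the cut determined by the block `y_k` of a cut generating vector. -/
def cutPair {p : ℕ} (y : Fin (p + 1) → S) :
    Prog S ((Fin (p + 1) → S) × (Fin (p + 1) → S)) := do
  let zero ← .lit 0
  let one ← .lit 1
  let two ← .lit 2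
  let three ← .lit 3
  let five ← .lit 5
  let thr ← .div three five
  let rt ← .sqrt two
  let irt ← .div one rt
  let q ← tailSq y
  let t ← .sqrt q
  let η ← .div t (y 0)
  let b ← .le η thr
  if b then
    .ret (y, Fin.cons irt (fun _ => zero))
  else do
    let η2 ← .mul η η
    let c ← .sub one irt
    let κ ← .div c η2
    let u ← fill (fun _ => zero) (List.finRange p) (fun a => do
      let x ← .div (y a.succ) (y 0)
      .mul κ x)
    let u' ← fill (fun _ => zero) (List.finRange p) (fun a => .sub zero (u a))
    .ret (Fin.cons one u, Fin.cons one u')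

/-- The parameters `(c, α, β)` of the automorphism
`G = c [α, -βᵀ; -β, I + β βᵀ / (1 + α)]`, with `(α; β) = w / √(w₀² - ‖w₁‖²)` and
`c = (α; β)ᵀ v`.  Its determinant is `c ^ d`. -/
def autParams {p : ℕ} (w v : Fin (p + 1) → S) : Prog S (S × S × (Fin p → S)) := do
  let zero ← .lit 0
  let a ← .mul (w 0) (w 0)
  let q ← tailSq w
  let g ← .sub a q
  let γ ← .sqrt g
  let α ← .div (w 0) γ
  let β ← fill (fun _ => zero) (List.finRange p) (fun a => .div (w a.succ) γ)
  let s ← .mul α (v 0)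
  let s' ← dot (List.finRange p) β (fun a => v a.succ)
  let c ← .add s s'
  .ret (c, α, β)

/-- The product of a row vector `x` and the symmetric matrix
`c [α, -βᵀ; -β, I + β βᵀ / (1 + α)]`. -/
def applyAut {p : ℕ} (c α : S) (β : Fin p → S) (x : Fin (p + 1) → S) :
    Prog S (Fin (p + 1) → S) := do
  let one ← .lit 1
  let t ← dot (List.finRange p) β (fun a => x a.succ)
  let α1 ← .add one α
  let q ← .div t α1
  let h ← .mul α (x 0)
  let h' ← .sub h t
  let h'' ← .mul c h'
  let u ← fill (fun _ => h'') (List.finRange p) (fun a => do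
    let b ← .sub q (x 0)
    let b' ← .mul (β a) b
    let b'' ← .add (x a.succ) b'
    .mul c b'')
  .ret (Fin.cons h'' u)

/-- State of the main algorithm: the scaled matrix `A M`, the scaling matrix `M` by its diagonal
blocks, the blocks of `M⁻ᵀ`, and the numbers `v_i = det M_i`. -/
structure MainState (S : Type) (m : ℕ) {n : ℕ} (r : Fin n → ℕ) : Type where
  A : Fin m → Idx r → S
  M : (i : Fin n) → Fin (r i + 1) → Fin (r i + 1) → S
  L : (i : Fin n) → Fin (r i + 1) → Fin (r i + 1) → S
  v : Fin n → S

/-- Outputs of the main algorithm. -/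
inductive MainOut (S : Type) {n : ℕ} (r : Fin n → ℕ) : Type
  | primal (x : Idx r → S)
  | dual (s : Idx r → S)
  | noInterior

/-- The initial state. -/
def mainInit (A : Fin m → Idx r → S) : Prog S (MainState S m r) := do
  let zero ← .lit 0
  let one ← .lit 1
  .ret { A := A
         M := fun _ a b => if a = b then one else zero
         L := fun _ a b => if a = b then one else zero
         v := fun _ => one }

/-- The starting point `e / n` of the basic procedure. -/
def startVec (r : Fin n → ℕ) : Prog S (Idx r → S) := do
  let zero ← .lit 0
  let one ← .lit 1
  let nn ← .lit n
  let y0 ← .div one nn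
  .ret (fun q => if q.2 = 0 then y0 else zero)

/-- Block-diagonal matrix times vector. -/
def mulBlocks (B : (i : Fin n) → Fin (r i + 1) → Fin (r i + 1) → S) (x : Idx r → S) :
    Prog S (Idx r → S) := do
  let zero ← .lit 0
  fill (fun _ => zero) (idxList r)
    (fun q => dot (List.finRange (r q.1 + 1)) (B q.1 q.2) (blk x q.1))

/-- The scaling of block `k` after a cut with cut generating vector `y`. -/
def rescale (s : MainState S m r) (y : Idx r → S) (k : Fin n) : Prog S (MainState S m r) := do
  let wv ← cutPair (blk y k)
  let g ← autParams wv.1 wv.2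
  let c := g.1
  let α := g.2.1
  let β := g.2.2
  let zero ← .lit 0
  let one ← .lit 1
  let c' ← .div one c
  let β' ← fill β (List.finRange (r k)) (fun a => .sub zero (β a))
  let A' ← fill s.A (List.finRange m) (fun j => do
    let row ← applyAut c α β (blk (s.A j) k)
    .ret (setBlk (s.A j) k row))
  let Mk ← fill (s.M k) (List.finRange (r k + 1)) (fun a => applyAut c α β (s.M k a))
  let Lk ← fill (s.L k) (List.finRange (r k + 1)) (fun a => applyAut c' α β' (s.L k a))
  let vk ← mulPow (s.v k) c (r k + 1)
  .ret { A := A'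
         M := Function.update s.M k Mk
         L := Function.update s.L k Lk
         v := Function.update s.v k vk }

/-- One pass through the main algorithm up to the stopping test: call the basic procedure; either
return a solution of the original problem, or cut and rescale a block `k`. -/
def mainIter (y₀ : Idx r → S) (s : MainState S m r) :
    Prog S (MainOut S r ⊕ (MainState S m r × Fin n)) := do
  let out ← .call (basicProcedure s.A y₀)
  match out with
  | .primal x => do
      let x' ← mulBlocks s.M x
      .ret (Sum.inl (.primal x'))
  | .dual y => do
      let y' ← mulBlocks s.L y
      .ret (Sum.inl (.dual y'))
  | .cut y k => do
      let s' ← rescale s y k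
      .ret (Sum.inr (s', k))

/-- One pass through the main algorithm, with the stopping test `v_k ≤ ε ^ d_k`. -/
def mainBody (ε : S) (y₀ : Idx r → S) (s : MainState S m r) :
    Prog S (MainState S m r ⊕ MainOut S r) := do
  let res ← mainIter y₀ s
  match res with
  | .inl out => .ret (Sum.inr out)
  | .inr sk => do
      let one ← .lit 1
      let thr ← mulPow one ε (r sk.2 + 1)
      let small ← .le (sk.1.v sk.2) thr
      if small then .ret (Sum.inr .noInterior) else .ret (Sum.inl sk.1)

/-- The main algorithm. -/
def mainAlgorithm (A : Fin m → Idx r → S) (ε : S) : Prog S (MainOut S r) := do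
  let y₀ ← startVec r
  let s ← mainInit A
  .loop (mainBody ε y₀) s

end Algorithm

/-! ## Notions for the analysis of the main algorithm -/

/-- The outputs are what they claim to be. -/
def MainOut.Correct {n m : ℕ} {r : Fin n → ℕ} (A : Matrix (Fin m) (Idx r) ℝ) (ε : ℝ) :
    MainOut ℝ r → Prop
  | .primal x => A.mulVec x = 0 ∧ x ∈ interior (prodCone r)
  | .dual s => (∃ u : Fin m → ℝ, s = -(A.transpose.mulVec u)) ∧ s ∈ prodCone r ∧ s ≠ 0
  | .noInterior => ¬ ∃ x : Idx r → ℝ, A.mulVec x = 0 ∧ ‖x‖ ≤ 1 ∧ ε ≤ lambdaMin x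

/-- The states of the main algorithm at the beginning of its passes, in all executions. -/
inductive Reached {n m : ℕ} {r : Fin n → ℕ} (A : Matrix (Fin m) (Idx r) ℝ) (ε : ℝ)
    (y₀ : Idx r → ℝ) : MainState ℝ m r → Prop
  | init {s : MainState ℝ m r} {c : Prog.Cost} (h : (mainInit (fun j => A j)).Runs s c) :
      Reached A ε y₀ s
  | step {s s' : MainState ℝ m r} {c : Prog.Cost} (hs : Reached A ε y₀ s)
      (h : (mainBody ε y₀ s).Runs (Sum.inl s') c) : Reached A ε y₀ s'

/-- The region `M_i 𝒞(e_i, e_i)` of block `i` that belongs to a state. -/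
def MainState.region {n m : ℕ} {r : Fin n → ℕ} (s : MainState ℝ m r) (i : Fin n) :
    Set (Fin (r i + 1) → ℝ) :=
  (fun x => (Matrix.of (s.M i)).mulVec x) '' truncCone (axis (r i)) (axis (r i))

/-- Every region is an obliquely truncated cone that contains the projection of `ℱ`. -/
def MainState.Encloses {n m : ℕ} {r : Fin n → ℕ} (A : Matrix (Fin m) (Idx r) ℝ)
    (s : MainState ℝ m r) : Prop :=
  ∀ i, feasibleBlk A i ⊆ s.region i ∧
    ∃ w ∈ interior (soc (r i)), ∃ v ∈ interior (soc (r i)), s.region i = truncCone w v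

/-! The proof joins a von Neumann style descent inside the basic procedure to a volume argument
outside it.

Basic procedure. The iterate `y` stays in the interior of the cone with heads summing to 1, and `z =
P y`. If `z` has a bad block, the separator `η` lies in the cone, has head 1 and hence `‖η‖² ≤ 2`,
and satisfies `ηᵀz ≤ 0`. So `p = P η` has `‖p‖² ≤ 2` and `pᵀz = ηᵀz ≤ 0`. The next `z` is the
shortest point of the segment between `z` and `p`; as these vectors form a non-acute angle, `1/‖z‖²`
grows by at least `1/‖p‖² ≥ 1/2` (`segment_min_bound`). After `8 n³` steps `‖z‖² ≤ 1/(4n³)`, and the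
largest head of `y`, which is at least `1/n`, satisfies the cut test (`BPInv.exists_cut`). A step
costs only `O(n̄ d)`, with `d` the largest block dimension, because `η` occupies one block.

A cut. Let `x` be feasible and `u = M⁻¹x`. Heads of `u` are at most 1, so `‖u‖² ≤ 2n`. As `y - z`
lies in the row space of `A M`, `y_kᵀu_k ≤ yᵀu = zᵀu ≤ √(2n) ‖z‖ ≤ y_{k0}/√2` (`cut_dotProduct_le`).
A nonnegative combination of this with `u_{k0} ≤ 1` is `wᵀu_k ≤ wᵀv`. The automorphism `G` is chosen
such that the head of `G⁻¹u_k` is `wᵀu_k / wᵀv`, so the new heads are again at most 1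
(`CutVectors.cutBoost`). Moreover `|det G| = c^d` with `c = wᵀv/√(w₀² - ‖w₁‖²) ≤ 0.96`.

Main algorithm. Block `i` carries a factor `γ_i`, the product of its `c`'s; `M_i` preserves the cone
and multiplies `x₀² - ‖x₁‖²` by `γ_i²`. The stopping test says `γ_k ≤ ε`. A feasible point with
minimum eigenvalue at least `ε` has quadratic form at least `ε²` in block `k`, whereas its scaled
block has head, hence form, strictly below 1: a contradiction
(`MainState.CutStep.noInterior_correct`). A block cut `J` times has `γ ≤ 0.96^J`, so each block
survives `O(max{1, log ε⁻¹})` cuts.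

Legality, running time and correctness are proved together, by a Hoare calculus with costs (`Spec`)
whose loop rule takes a decreasing counter. -/

namespace Prog

/-! ### A Hoare calculus with costs. -/

variable {α β σ ι : Type}

/-- Every execution of `p` is finite and legal, returns a value with the property `Q`, and costs at
most `N` operations and at most `K` counted calls. -/
def Spec (p : Prog ℝ α) (Q : α → Prop) (N : ℕ) (K : ℕ := 0) : Prop :=
  p.Halts ∧ ∀ a c, p.Runs a c → Q a ∧ c.1 ≤ N ∧ c.2 ≤ K

variable {p : Prog ℝ α} {Q Q' : α → Prop} {N N' N₁ N₂ K K' : ℕ}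

theorem Spec.mono (h : Spec p Q N K) (hQ : ∀ a, Q a → Q' a) (hN : N ≤ N') (hK : K ≤ K') :
    Spec p Q' N' K' :=
  ⟨h.1, fun a c hr => ⟨hQ a (h.2 a c hr).1, (h.2 a c hr).2.1.trans hN, (h.2 a c hr).2.2.trans hK⟩⟩

theorem Spec.le (h : Spec p Q N K) (hN : N ≤ N') : Spec p Q N' K :=
  h.mono (fun _ h => h) hN le_rfl

theorem Spec.imp (h : Spec p Q N K) (hQ : ∀ a, Q a → Q' a) : Spec p Q' N K :=
  h.mono hQ le_rfl le_rfl

theorem Spec.ret {a : α} (h : Q a) : Spec (.ret a) Q 0 :=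
  ⟨trivial, by rintro _ _ ⟨rfl, rfl⟩; exact ⟨h, le_rfl, le_rfl⟩⟩

/-- The continuation is examined only at values satisfying `Q`; this is how facts such as nonzero
divisors reach later instructions. -/
theorem Spec.bind_add {f : α → Prog ℝ β} {R : β → Prop} (hp : Spec p Q N₁ K)
    (hf : ∀ a, Q a → Spec (f a) R N₂ K') : Spec (p >>= f) R (N₁ + N₂) (K + K') := by
  refine ⟨⟨hp.1, fun a c h => (hf a (hp.2 a c h).1).1⟩, ?_⟩
  rintro b _ ⟨a, c₁, c₂, h₁, h₂, rfl⟩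
  obtain ⟨hQ, h1, h1'⟩ := hp.2 a c₁ h₁
  obtain ⟨hR, h2, h2'⟩ := (hf a hQ).2 b c₂ h₂
  exact ⟨hR, add_le_add h1 h2, add_le_add h1' h2'⟩

theorem Spec.bind {f : α → Prog ℝ β} {R : β → Prop} (hp : Spec p Q N₁)
    (hf : ∀ a, Q a → Spec (f a) R N₂ K) : Spec (p >>= f) R (N₁ + N₂) K := by
  simpa using hp.bind_add hf

theorem Spec.bind_eq {f : α → Prog ℝ β} {R : β → Prop} {a : α} (hp : Spec p (· = a) N₁)
    (hf : Spec (f a) R N₂ K) : Spec (p >>= f) R (N₁ + N₂) K :=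
  hp.bind (by rintro _ rfl; exact hf)

theorem Spec.lit (k : ℕ) : Spec (.lit k) (· = (k : ℝ)) 1 :=
  ⟨trivial, by rintro _ _ ⟨rfl, rfl⟩; exact ⟨rfl, le_rfl, Nat.zero_le _⟩⟩

theorem Spec.lit_zero : Spec (.lit 0) (· = (0 : ℝ)) 1 := by simpa using Spec.lit 0

theorem Spec.lit_one : Spec (.lit 1) (· = (1 : ℝ)) 1 := by simpa using Spec.lit 1

theorem Spec.add (a b : ℝ) : Spec (.add a b) (· = a + b) 1 :=
  ⟨trivial, by rintro _ _ ⟨rfl, rfl⟩; exact ⟨rfl, le_rfl, Nat.zero_le _⟩⟩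

theorem Spec.sub (a b : ℝ) : Spec (.sub a b) (· = a - b) 1 :=
  ⟨trivial, by rintro _ _ ⟨rfl, rfl⟩; exact ⟨rfl, le_rfl, Nat.zero_le _⟩⟩

theorem Spec.mul (a b : ℝ) : Spec (.mul a b) (· = a * b) 1 :=
  ⟨trivial, by rintro _ _ ⟨rfl, rfl⟩; exact ⟨rfl, le_rfl, Nat.zero_le _⟩⟩

theorem Spec.div (a : ℝ) {b : ℝ} (hb : b ≠ 0) : Spec (.div a b) (· = a / b) 1 :=
  ⟨hb, by rintro _ _ ⟨_, rfl, rfl⟩; exact ⟨rfl, le_rfl, Nat.zero_le _⟩⟩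

theorem Spec.sqrt {a : ℝ} (ha : 0 ≤ a) : Spec (.sqrt a) (· = Real.sqrt a) 1 :=
  ⟨ha, by rintro _ _ ⟨_, rfl, rfl⟩; exact ⟨rfl, le_rfl, Nat.zero_le _⟩⟩

theorem Spec.comp_le (a b : ℝ) : Spec (.le a b) (fun x => x = true ↔ a ≤ b) 1 :=
  ⟨trivial, by rintro _ _ ⟨h, rfl⟩; exact ⟨h, le_rfl, Nat.zero_le _⟩⟩

theorem Spec.choose {l : List α} (hl : l ≠ []) : Spec (.choose l) (· ∈ l) 0 :=
  ⟨hl, by rintro _ _ ⟨h, rfl⟩; exact ⟨h, le_rfl, le_rfl⟩⟩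

theorem Spec.call (h : Spec p Q N K) : Spec (.call p) Q N (K + 1) :=
  ⟨h.1, by
    rintro a _ ⟨c, hc, rfl⟩
    obtain ⟨h1, h2, h3⟩ := h.2 a c hc
    exact ⟨h1, by simpa using h2, by simpa using h3⟩⟩

theorem Spec.ite {b : Bool} {p q : Prog ℝ α} (hp : b = true → Spec p Q N₁ K)
    (hq : b ≠ true → Spec q Q N₂ K) : Spec (if b then p else q) Q (N₁ + N₂) K := by
  split_ifs with h
  · exact (hp h).le (Nat.le_add_right _ _)
  · exact (hq h).le (Nat.le_add_left _ _)

/-- The index `k` of the invariant is a variant: it bounds the passes that may still continue.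
Strong induction on it gives halting and cost at once; the extra 1 in `k + 1` pays for the pass that
exits. -/
theorem Spec.loop {body : σ → Prog ℝ (σ ⊕ α)} {Inv : ℕ → σ → Prop}
    (hbody : ∀ k s, Inv k s →
      Spec (body s) (Sum.elim (fun s' => ∃ k', k' < k ∧ Inv k' s') Q) N K) :
    ∀ (k : ℕ) (s : σ), Inv k s → Spec (.loop body s) Q ((k + 1) * N) ((k + 1) * K) := by
  intro k
  induction k using Nat.strong_induction_on with
  | _ k ih =>
    intro s hs
    have hb := hbody k s hs
    refine ⟨LoopHalts.intro hb.1 fun s' c h => ?_, ?_⟩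
    · obtain ⟨k', hk', hs'⟩ := (hb.2 _ c h).1
      exact (ih k' hk' s' hs').1
    · intro a c h
      change LoopRuns (fun s' => Runs (body s')) s a c at h
      cases h with
      | done h =>
        obtain ⟨h1, h2, h3⟩ := hb.2 _ c h
        exact ⟨h1, h2.trans (Nat.le_mul_of_pos_left _ (Nat.succ_pos k)),
          h3.trans (Nat.le_mul_of_pos_left _ (Nat.succ_pos k))⟩
      | @more _ s' _ c₁ c₂ h h' =>
        obtain ⟨⟨k', hk', hs'⟩, h2, h3⟩ := hb.2 _ _ h
        obtain ⟨h1, h4, h5⟩ := (ih k' hk' s' hs').2 a c₂ h'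
        have hk : k' + 1 ≤ k := hk'
        refine ⟨h1, ?_, ?_⟩
        · calc c₁.1 + c₂.1 ≤ N + k * N :=
                add_le_add h2 (h4.trans (Nat.mul_le_mul_right _ hk))
            _ = (k + 1) * N := by ring
        · calc c₁.2 + c₂.2 ≤ K + k * K :=
                add_le_add h3 (h5.trans (Nat.mul_le_mul_right _ hk))
            _ = (k + 1) * K := by ring

/-- An invariant of a bounded loop, indexed by the list of the items processed so far. -/
theorem Spec.iter_prefix {l : List ι} {f : ι → β → Prog ℝ β} {Inv : List ι → β → Prop}
    (hf : ∀ pre i post b, l = pre ++ i :: post → Inv pre b → Spec (f i b) (Inv (pre ++ [i])) N)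
    {b : β} (hb : Inv [] b) : Spec (iter l f b) (Inv l) (l.length * N) := by
  suffices H : ∀ (post pre : List ι) (b : β), l = pre ++ post → Inv pre b →
      Spec (iter post f b) (Inv l) (post.length * N) from H l [] b rfl hb
  intro post
  induction post with
  | nil =>
    intro pre b hl hb
    rw [List.append_nil] at hl
    subst hl
    simpa [iter] using Spec.ret hb
  | cons i post ih =>
    intro pre b hl hb
    refine Spec.le ((hf pre i post b hl hb).bind fun b' hb' => ih (pre ++ [i]) b' ?_ hb') ?_
    · rw [hl]; simp
    · rw [List.length_cons]; exact le_of_eq (by ring)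

theorem Spec.sumOver {l : List ι} {f : ι → Prog ℝ ℝ} {g : ι → ℝ}
    (hf : ∀ i ∈ l, Spec (f i) (· = g i) N) :
    Spec (Prog.sumOver l f) (· = (l.map g).sum) (1 + l.length * (N + 1)) := by
  refine Spec.lit_zero.bind_eq ?_
  refine Spec.iter_prefix (Inv := fun pre b => b = (pre.map g).sum) ?_ rfl
  rintro pre i post _ hl rfl
  refine (hf i (by simp [hl])).bind_eq ((Spec.add _ _).imp ?_)
  rintro _ rfl
  simp

theorem Spec.dot (l : List ι) (x y : ι → ℝ) :
    Spec (Prog.dot l x y) (· = (l.map fun i => x i * y i).sum) (1 + l.length * 2) :=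
  Spec.sumOver fun i _ => Spec.mul (x i) (y i)

theorem Spec.fill [DecidableEq ι] {l : List ι} {f : ι → Prog ℝ β} {g v : ι → β}
    (hf : ∀ i ∈ l, Spec (f i) (· = g i) N) :
    Spec (Prog.fill v l f) (· = fun i => if i ∈ l then g i else v i) (l.length * N) := by
  refine Spec.iter_prefix (Inv := fun pre w => w = fun i => if i ∈ pre then g i else v i)
    ?_ (by simp)
  rintro pre i post _ hl rfl
  refine Spec.le ((hf i (by simp [hl])).bind_eq (Spec.ret ?_)) (Nat.add_zero N).le
  funext j
  by_cases hj : j = i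
  · subst hj; simp
  · simp [hj]

theorem Spec.fill_all [DecidableEq ι] {l : List ι} (hl : ∀ i, i ∈ l) {f : ι → Prog ℝ β}
    {g : ι → β} (v : ι → β) (hf : ∀ i, Spec (f i) (· = g i) N) :
    Spec (Prog.fill v l f) (· = g) (l.length * N) := by
  have := Spec.fill (v := v) (l := l) fun i _ => hf i
  simpa [hl] using this

theorem Spec.select {l : List ι} {test : ι → Prog ℝ Bool} {T : ι → Prop}
    (ht : ∀ i ∈ l, Spec (test i) (fun b => b = true ↔ T i) N) :
    Spec (Prog.select l test) (fun l' => ∀ i, i ∈ l' ↔ i ∈ l ∧ T i) (l.length * N) := by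
  induction l with
  | nil => simpa [Prog.select] using Spec.ret (Q := fun l' : List ι => ∀ i, i ∉ l') (by simp)
  | cons i l ih =>
    refine Spec.le ((ht i (by simp)).bind fun b hb =>
      (ih fun j hj => ht j (by simp [hj])).bind fun l' hl' => Spec.ret ?_) ?_
    · intro j
      have h1 := hl' j
      cases b
      · have h2 : ¬ T i := by simpa using hb
        simp only [Bool.false_eq_true, if_false, h1, List.mem_cons]
        constructor
        · rintro ⟨h, h'⟩; exact ⟨Or.inr h, h'⟩
        · rintro ⟨rfl | h, h'⟩
          · exact absurd h' h2
          · exact ⟨h, h'⟩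
      · have h2 : T i := by simpa using hb
        simp only [if_true, h1, List.mem_cons]
        constructor
        · rintro (rfl | ⟨h, h'⟩)
          · exact ⟨Or.inl rfl, h2⟩
          · exact ⟨Or.inr h, h'⟩
        · rintro ⟨rfl | h, h'⟩
          · exact Or.inl rfl
          · exact Or.inr ⟨h, h'⟩
    · rw [List.length_cons]; exact le_of_eq (by ring)

theorem Spec.mulPow (acc a : ℝ) (k : ℕ) : Spec (Prog.mulPow acc a k) (· = acc * a ^ k) k := by
  have : Spec (Prog.mulPow acc a k) (fun b => b = acc * a ^ (List.range k).length)
      ((List.range k).length * 1) := by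
    refine Spec.iter_prefix (Inv := fun pre b => b = acc * a ^ pre.length) ?_ (by simp)
    rintro pre i post _ hl rfl
    refine (Spec.mul _ _).imp ?_
    rintro _ rfl
    rw [List.length_append, List.length_singleton]; ring
  simpa using this

end Prog

/-! ### From sums over enumerating lists to finite sums. -/

theorem sum_map_of_enum {ι : Type} [Fintype ι] {l : List ι} (hn : l.Nodup)
    (hl : ∀ i, i ∈ l) (f : ι → ℝ) : (l.map f).sum = ∑ i, f i := by
  classical
  rw [← List.sum_toFinset f hn]
  congr 1
  ext i; simp [hl]

theorem Prog.Spec.dot_enum {ι : Type} [Fintype ι] {l : List ι} (hn : l.Nodup) (hl : ∀ i, i ∈ l)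
    (x y : ι → ℝ) : Prog.Spec (Prog.dot l x y) (· = x ⬝ᵥ y) (1 + l.length * 2) := by
  have := Prog.Spec.dot l x y
  rwa [sum_map_of_enum hn hl] at this

theorem mem_idxList {n : ℕ} {r : Fin n → ℕ} (q : Idx r) : q ∈ idxList r := by
  obtain ⟨i, a⟩ := q
  simp [idxList]

theorem nodup_idxList {n : ℕ} (r : Fin n → ℕ) : (idxList r).Nodup :=
  (List.nodup_finRange n).sigma fun i => List.nodup_finRange (r i + 1)

theorem length_idxList {n : ℕ} (r : Fin n → ℕ) : (idxList r).length = ∑ i, (r i + 1) := by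
  have h : (idxList r).toFinset = Finset.univ := by ext q; simp [mem_idxList]
  rw [← List.toFinset_card_of_nodup (nodup_idxList r), h, Finset.card_univ, Fintype.card_sigma]
  simp

theorem Prog.Spec.dot_fin {p : ℕ} (x y : Fin p → ℝ) :
    Prog.Spec (Prog.dot (List.finRange p) x y) (· = x ⬝ᵥ y) (1 + p * 2) := by
  simpa using Prog.Spec.dot_enum (List.nodup_finRange p) (by simp) x y

theorem Prog.Spec.dot_idx {n : ℕ} {r : Fin n → ℕ} (x y : Idx r → ℝ) :
    Prog.Spec (Prog.dot (idxList r) x y) (· = x ⬝ᵥ y) (1 + (∑ i, (r i + 1)) * 2) := by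
  simpa [length_idxList] using Prog.Spec.dot_enum (nodup_idxList r) mem_idxList x y

theorem Prog.Spec.fill_fin {p N : ℕ} {β : Type} {f : Fin p → Prog ℝ β} {g : Fin p → β}
    (v : Fin p → β) (hf : ∀ i, Prog.Spec (f i) (· = g i) N) :
    Prog.Spec (Prog.fill v (List.finRange p) f) (· = g) (p * N) := by
  simpa using Prog.Spec.fill_all (List.mem_finRange) v hf

theorem Prog.Spec.fill_idx {n N : ℕ} {r : Fin n → ℕ} {β : Type} {f : Idx r → Prog ℝ β}
    {g : Idx r → β} (v : Idx r → β) (hf : ∀ q, Prog.Spec (f q) (· = g q) N) :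
    Prog.Spec (Prog.fill v (idxList r) f) (· = g) ((∑ i, (r i + 1)) * N) := by
  simpa [length_idxList] using Prog.Spec.fill_all mem_idxList v hf

/-! ### Geometry of the cone -/

section Cone

variable {p : ℕ}

/-- The quadratic form `x₀² - ‖x₁‖²`. -/
def lorentz (x : Fin (p + 1) → ℝ) : ℝ := x 0 ^ 2 - ∑ a : Fin p, x a.succ ^ 2

theorem sum_sq_tail_nonneg (x : Fin (p + 1) → ℝ) : 0 ≤ ∑ a : Fin p, x a.succ ^ 2 :=
  Finset.sum_nonneg fun _ _ => sq_nonneg _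

theorem tailNorm_nonneg (x : Fin (p + 1) → ℝ) : 0 ≤ tailNorm x := Real.sqrt_nonneg _

theorem tailNorm_sq (x : Fin (p + 1) → ℝ) : tailNorm x ^ 2 = ∑ a : Fin p, x a.succ ^ 2 :=
  Real.sq_sqrt (sum_sq_tail_nonneg x)

theorem lorentz_eq (x : Fin (p + 1) → ℝ) : lorentz x = x 0 ^ 2 - tailNorm x ^ 2 := by
  rw [tailNorm_sq, lorentz]

/-- Expresses membership by the sign of the head and of the quadratic form, the two quantities that
a scaled automorphism controls. -/
theorem mem_soc_iff {x : Fin (p + 1) → ℝ} : x ∈ soc p ↔ 0 ≤ x 0 ∧ 0 ≤ lorentz x := by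
  rw [lorentz, sub_nonneg, ← Real.sqrt_le_iff]
  rfl

theorem tailNorm_lt_iff {x : Fin (p + 1) → ℝ} :
    tailNorm x < x 0 ↔ 0 ≤ x 0 ∧ 0 < lorentz x := by
  rw [lorentz_eq]
  have h := tailNorm_nonneg x
  constructor
  · intro h1; exact ⟨h.trans h1.le, by nlinarith⟩
  · rintro ⟨h1, h2⟩; nlinarith

theorem continuous_tailNorm : Continuous (tailNorm (p := p)) := by
  unfold tailNorm
  fun_prop

theorem mem_interior_soc {x : Fin (p + 1) → ℝ} (h : tailNorm x < x 0) :
    x ∈ interior (soc p) :=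
  mem_interior.2 ⟨{x | tailNorm x < x 0},
    fun y (hy : tailNorm y < y 0) => show tailNorm y ≤ y 0 from hy.le,
    isOpen_lt continuous_tailNorm (continuous_apply 0), h⟩

theorem mem_interior_prodCone {n : ℕ} {r : Fin n → ℕ} {x : Idx r → ℝ}
    (h : ∀ i, tailNorm (blk x i) < blk x i 0) : x ∈ interior (prodCone r) := by
  refine mem_interior.2 ⟨⋂ i, {x | tailNorm (blk x i) < blk x i 0},
    fun y hy i => show tailNorm _ ≤ _ from
      le_of_lt (show tailNorm (blk y i) < blk y i 0 from Set.mem_iInter.1 hy i),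
    isOpen_iInter_of_finite fun i => ?_,
    Set.mem_iInter.2 h⟩
  have hb : Continuous fun x : Idx r → ℝ => blk x i := by unfold blk; fun_prop
  exact isOpen_lt (continuous_tailNorm.comp hb) ((continuous_apply 0).comp hb)

theorem dotProduct_eq_head_add (x y : Fin (p + 1) → ℝ) :
    x ⬝ᵥ y = x 0 * y 0 + ∑ a : Fin p, x a.succ * y a.succ := by
  rw [dotProduct, Fin.sum_univ_succ]

theorem dotProduct_nonneg_of_mem_soc {x y : Fin (p + 1) → ℝ} (hx : x ∈ soc p)
    (hy : y ∈ soc p) : 0 ≤ x ⬝ᵥ y := by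
  have h : ∑ a : Fin p, (-x a.succ) * y a.succ ≤ tailNorm x * tailNorm y := by
    simpa [tailNorm] using Real.sum_mul_le_sqrt_mul_sqrt Finset.univ
      (fun a : Fin p => -x a.succ) (fun a => y a.succ)
  have h1 : ∑ a : Fin p, (-x a.succ) * y a.succ = -∑ a : Fin p, x a.succ * y a.succ := by
    simp
  have h2 : tailNorm x * tailNorm y ≤ x 0 * y 0 :=
    mul_le_mul hx hy (tailNorm_nonneg y) ((tailNorm_nonneg x).trans hx)
  rw [dotProduct_eq_head_add]
  linarith

theorem tailNorm_eq_norm (x : Fin (p + 1) → ℝ) :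
    tailNorm x = ‖WithLp.toLp 2 (fun a : Fin p => x a.succ)‖ := by
  simp [EuclideanSpace.norm_eq, tailNorm]

theorem tailNorm_comb_le {a b : ℝ} (ha : 0 ≤ a) (hb : 0 ≤ b) (x y : Fin (p + 1) → ℝ) :
    tailNorm (a • x + b • y) ≤ a * tailNorm x + b * tailNorm y := by
  simp only [tailNorm_eq_norm]
  have h : WithLp.toLp 2 (fun i : Fin p => (a • x + b • y) i.succ) =
      a • WithLp.toLp 2 (fun i : Fin p => x i.succ) +
        b • WithLp.toLp 2 (fun i : Fin p => y i.succ) := by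
    ext i; simp
  rw [h]
  refine (norm_add_le _ _).trans (le_of_eq ?_)
  rw [norm_smul, norm_smul, Real.norm_of_nonneg ha, Real.norm_of_nonneg hb]

theorem tailNorm_axis : tailNorm (axis p) = 0 := by
  simp [tailNorm, axis]

theorem axis_dotProduct (x : Fin (p + 1) → ℝ) : axis p ⬝ᵥ x = x 0 := by
  simp [axis]

/-! ### Scaled automorphisms of the cone -/

/-- `M` maps the cone into itself and multiplies the quadratic form by `γ ^ 2`. -/
structure ScalesCone (γ : ℝ) (M : Matrix (Fin (p + 1)) (Fin (p + 1)) ℝ) : Prop where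
  nonneg : ∀ x ∈ soc p, 0 ≤ (M.mulVec x) 0
  form : ∀ x, lorentz (M.mulVec x) = γ ^ 2 * lorentz x

namespace ScalesCone

variable {γ δ : ℝ} {M N : Matrix (Fin (p + 1)) (Fin (p + 1)) ℝ}

theorem mulVec_mem (h : ScalesCone γ M) {x : Fin (p + 1) → ℝ} (hx : x ∈ soc p) :
    M.mulVec x ∈ soc p :=
  mem_soc_iff.2 ⟨h.nonneg x hx, by
    rw [h.form]; exact mul_nonneg (sq_nonneg γ) (mem_soc_iff.1 hx).2⟩

theorem mulVec_interior (h : ScalesCone γ M) (hγ : γ ≠ 0) {x : Fin (p + 1) → ℝ}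
    (hx : tailNorm x < x 0) : tailNorm (M.mulVec x) < M.mulVec x 0 :=
  tailNorm_lt_iff.2 ⟨h.nonneg x hx.le, by
    rw [h.form]; exact mul_pos (by positivity) (tailNorm_lt_iff.1 hx).2⟩

theorem one : ScalesCone 1 (1 : Matrix (Fin (p + 1)) (Fin (p + 1)) ℝ) :=
  ⟨fun x hx => by simpa using (mem_soc_iff.1 hx).1, fun x => by simp⟩

theorem mul (h : ScalesCone γ M) (h' : ScalesCone δ N) : ScalesCone (γ * δ) (M * N) :=
  ⟨fun x hx => by rw [← Matrix.mulVec_mulVec]; exact h.nonneg _ (h'.mulVec_mem hx),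
    fun x => by rw [← Matrix.mulVec_mulVec, h.form, h'.form]; ring⟩

end ScalesCone

/-- The matrix `c [α, -βᵀ; -β, I + β βᵀ / (1 + α)]`. -/
noncomputable def boost (c α : ℝ) (β : Fin p → ℝ) : Matrix (Fin (p + 1)) (Fin (p + 1)) ℝ :=
  Matrix.of (Fin.cons (α := fun _ => Fin (p + 1) → ℝ)
    (Fin.cons (α := fun _ => ℝ) (c * α) fun b => -(c * β b))
    fun a => Fin.cons (α := fun _ => ℝ) (-(c * β a)) fun b =>
      c * ((if a = b then 1 else 0) + β a * β b / (1 + α)))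

theorem boost_mulVec (c α : ℝ) (β : Fin p → ℝ) (x : Fin (p + 1) → ℝ) :
    (boost c α β).mulVec x = Fin.cons (α := fun _ => ℝ)
      (c * (α * x 0 - β ⬝ᵥ fun a => x a.succ))
      fun a => c * (x a.succ + β a * ((β ⬝ᵥ fun a => x a.succ) / (1 + α) - x 0)) := by
  funext i
  refine Fin.cases ?_ (fun a => ?_) i
  · simp only [Matrix.mulVec, dotProduct, Fin.sum_univ_succ, boost, Matrix.of_apply,
      Fin.cons_zero, Fin.cons_succ, Finset.mul_sum, sub_eq_add_neg, mul_add, mul_neg,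
      neg_mul, mul_assoc, Finset.sum_neg_distrib]
  · simp only [Matrix.mulVec, dotProduct, Fin.sum_univ_succ, boost, Matrix.of_apply,
      Fin.cons_zero, Fin.cons_succ, mul_add, add_mul, Finset.sum_add_distrib, mul_ite, ite_mul,
      mul_one, mul_zero, zero_mul, Finset.sum_ite_eq, Finset.mem_univ, if_true, Finset.sum_div,
      mul_sub, Finset.mul_sum]
    have : ∑ b, c * (β a * β b / (1 + α)) * x b.succ =
        ∑ b, c * (β a * (β b * x b.succ / (1 + α))) :=
      Finset.sum_congr rfl fun _ _ => by ring
    rw [this]; ring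

theorem boost_transpose (c α : ℝ) (β : Fin p → ℝ) : (boost c α β).transpose = boost c α β := by
  ext i j
  rw [Matrix.transpose_apply]
  refine Fin.cases ?_ (fun a => ?_) i <;> refine Fin.cases ?_ (fun b => ?_) j <;>
    simp only [boost, Matrix.of_apply, Fin.cons_zero, Fin.cons_succ]
  rw [mul_comm (β b)]
  simp only [eq_comm]

section Unit

variable {c α : ℝ} {β : Fin p → ℝ}

/-- The head of the image is `c` times the inner product with `(α; -β)`, a vector of the self-dual
cone; the form is a direct computation from `‖β‖² = α² - 1`. -/
theorem boost_scalesCone (hc : 0 ≤ c) (hα : 0 < α) (h : α ^ 2 - ∑ a, β a ^ 2 = 1) :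
    ScalesCone c (boost c α β) := by
  constructor
  · intro x hx
    rw [boost_mulVec, Fin.cons_zero]
    refine mul_nonneg hc ?_
    have hb : (Fin.cons α (fun a => -β a) : Fin (p + 1) → ℝ) ∈ soc p :=
      mem_soc_iff.2 ⟨hα.le, by simp [lorentz, h]⟩
    have := dotProduct_nonneg_of_mem_soc hb hx
    rw [dotProduct_eq_head_add] at this
    simpa [dotProduct, sub_eq_add_neg] using this
  · intro x
    rw [boost_mulVec]
    simp only [lorentz, Fin.cons_zero, Fin.cons_succ]
    set t := β ⬝ᵥ fun a => x a.succ with ht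
    set s := t / (1 + α) - x 0 with hs
    have h1 : ∑ a : Fin p, (c * (x a.succ + β a * s)) ^ 2 =
        c ^ 2 * (∑ a : Fin p, x a.succ ^ 2 + 2 * s * t + s ^ 2 * ∑ a, β a ^ 2) := by
      rw [ht, dotProduct, Finset.mul_sum, Finset.mul_sum, ← Finset.sum_add_distrib,
        ← Finset.sum_add_distrib, Finset.mul_sum]
      exact Finset.sum_congr rfl fun _ _ => by ring
    have h2 : ∑ a, β a ^ 2 = α ^ 2 - 1 := by linarith
    have h3 : (1 + α) * (s + x 0) = t := by rw [hs]; field_simp; ring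
    rw [h1, h2, ← h3]
    ring

theorem boost_mul_boost (hc : c ≠ 0) (hα : 0 < α) (h : α ^ 2 - ∑ a, β a ^ 2 = 1) :
    boost c α β * boost c⁻¹ α (-β) = 1 := by
  refine Matrix.ext_of_mulVec_single fun i => ?_
  rw [← Matrix.mulVec_mulVec, Matrix.one_mulVec]
  generalize (Pi.single i 1 : Fin (p + 1) → ℝ) = x
  rw [boost_mulVec c⁻¹, boost_mulVec]
  simp only [Fin.cons_zero, Fin.cons_succ, neg_dotProduct, Pi.neg_apply]
  set t := β ⬝ᵥ fun a => x a.succ with ht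
  have h2 : β ⬝ᵥ β = α ^ 2 - 1 := by
    have : β ⬝ᵥ β = ∑ a, β a ^ 2 := Finset.sum_congr rfl fun _ _ => by ring
    linarith
  have h3 : (β ⬝ᵥ fun a => c⁻¹ * (x a.succ + -β a * (-t / (1 + α) - x 0))) =
      c⁻¹ * (t - (α ^ 2 - 1) * (-t / (1 + α) - x 0)) := by
    rw [← h2, ht, dotProduct, dotProduct, dotProduct, Finset.sum_mul, ← Finset.sum_sub_distrib,
      Finset.mul_sum]
    exact Finset.sum_congr rfl fun _ _ => by ring
  rw [h3]
  have h4 : (1 : ℝ) + α ≠ 0 := by positivity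
  funext j
  refine Fin.cases ?_ (fun a => ?_) j
  · rw [Fin.cons_zero]; field_simp; ring
  · rw [Fin.cons_succ]; field_simp; ring

theorem boost_eq_smul (c α : ℝ) (β : Fin p → ℝ) : boost c α β = c • boost 1 α β := by
  ext i j
  refine Fin.cases ?_ (fun a => ?_) i <;> refine Fin.cases ?_ (fun b => ?_) j <;>
    simp [boost]

/-- For `c = 1`, conjugation by the reflection `J = diag(1, -1, …, -1)` changes the sign of `β`,
which gives the inverse. A matrix conjugate to its inverse has determinant `±1`, and the sign is
irrelevant for volumes. -/
theorem abs_det_boost (hc : 0 ≤ c) (hα : 0 < α) (h : α ^ 2 - ∑ a, β a ^ 2 = 1) :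
    |(boost c α β).det| = c ^ (p + 1) := by
  have hdet : |(boost 1 α β).det| = 1 := by
    set J : Matrix (Fin (p + 1)) (Fin (p + 1)) ℝ :=
      Matrix.diagonal (Fin.cons 1 fun _ => -1) with hJ
    have hJJ : J * J = 1 := by
      rw [hJ, Matrix.diagonal_mul_diagonal, ← Matrix.diagonal_one]
      congr 1
      funext i
      refine Fin.cases ?_ (fun a => ?_) i <;> simp
    have hconj : J * boost 1 α β * J = boost 1 α (-β) := by
      ext i j
      rw [hJ, Matrix.mul_diagonal, Matrix.diagonal_mul]
      refine Fin.cases ?_ (fun a => ?_) i <;> refine Fin.cases ?_ (fun b => ?_) j <;>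
        simp [boost]
    have h1 := congrArg Matrix.det (boost_mul_boost one_ne_zero hα h)
    have h2 := congrArg Matrix.det hJJ
    rw [inv_one, ← hconj, Matrix.det_mul, Matrix.det_mul, Matrix.det_mul, Matrix.det_one] at h1
    rw [Matrix.det_mul, Matrix.det_one] at h2
    have h3 : (boost 1 α β).det ^ 2 = 1 := by
      linear_combination h1 - (boost 1 α β).det ^ 2 * h2
    rwa [← pow_eq_one_iff_of_nonneg (abs_nonneg _) two_ne_zero, sq_abs]
  rw [boost_eq_smul, Matrix.det_smul, abs_mul, hdet, Fintype.card_fin, abs_pow, abs_of_nonneg hc,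
    mul_one]

end Unit

/-- `M` is a scaled automorphism of the cone with factor `γ`, and `L` is its inverse transpose. -/
structure BlockScaling (γ : ℝ) (M L : Matrix (Fin (p + 1)) (Fin (p + 1)) ℝ) : Prop where
  pos : 0 < γ
  mul_transpose : M * L.transpose = 1
  scales : ScalesCone γ M
  scales_transpose : ScalesCone γ M.transpose
  scales_dual : ScalesCone γ⁻¹ L
  scales_dual_transpose : ScalesCone γ⁻¹ L.transpose

namespace BlockScaling

variable {γ : ℝ} {M L : Matrix (Fin (p + 1)) (Fin (p + 1)) ℝ}

theorem one : BlockScaling 1 (1 : Matrix (Fin (p + 1)) (Fin (p + 1)) ℝ) 1 := by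
  constructor <;> simp [ScalesCone.one]

theorem transpose_mul (h : BlockScaling γ M L) : L.transpose * M = 1 :=
  mul_eq_one_comm.1 h.mul_transpose

theorem mul_boost (h : BlockScaling γ M L) {c α : ℝ} {β : Fin p → ℝ} (hc : 0 < c)
    (hα : 0 < α) (hβ : α ^ 2 - ∑ a, β a ^ 2 = 1) :
    BlockScaling (γ * c) (M * boost c α β) (L * boost c⁻¹ α (-β)) := by
  have h1 := boost_scalesCone hc.le hα hβ
  have h2 : ScalesCone c⁻¹ (boost c⁻¹ α (-β)) :=
    boost_scalesCone (inv_nonneg.2 hc.le) hα (by simpa using hβ)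
  refine ⟨mul_pos h.pos hc, ?_, h.scales.mul h1, ?_, ?_, ?_⟩
  · rw [Matrix.transpose_mul, boost_transpose, Matrix.mul_assoc, ← Matrix.mul_assoc (boost c α β),
      boost_mul_boost hc.ne' hα hβ, Matrix.one_mul, h.mul_transpose]
  · rw [Matrix.transpose_mul, boost_transpose, mul_comm]
    exact h1.mul h.scales_transpose
  · rw [mul_inv]
    exact h.scales_dual.mul h2
  · rw [Matrix.transpose_mul, boost_transpose, mul_inv, mul_comm]
    exact h2.mul h.scales_dual_transpose

theorem mulVec_transpose_mulVec (h : BlockScaling γ M L) (x : Fin (p + 1) → ℝ) :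
    M.mulVec (L.transpose.mulVec x) = x := by
  rw [Matrix.mulVec_mulVec, h.mul_transpose, Matrix.one_mulVec]

theorem dual_dotProduct (h : BlockScaling γ M L) (x y : Fin (p + 1) → ℝ) :
    L.mulVec x ⬝ᵥ M.mulVec y = x ⬝ᵥ y := by
  rw [Matrix.dotProduct_mulVec, ← Matrix.mulVec_transpose, Matrix.mulVec_mulVec,
    ← Matrix.transpose_transpose (M.transpose * L), Matrix.transpose_mul,
    Matrix.transpose_transpose, h.transpose_mul, Matrix.transpose_one, Matrix.one_mulVec]

/-- Since `Lᵀ = M⁻¹` also preserves the cone, a point lies in the image exactly when it lies in the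
cone and its preimage `Lᵀx` has head at most 1. -/
theorem image_eq (h : BlockScaling γ M L) :
    (fun x => M.mulVec x) '' truncCone (axis p) (axis p) =
      {x | x ∈ soc p ∧ L.transpose.mulVec x 0 ≤ 1} := by
  ext x
  constructor
  · rintro ⟨u, ⟨hu, hu'⟩, rfl⟩
    refine ⟨h.scales.mulVec_mem hu, ?_⟩
    rw [axis_dotProduct, axis_dotProduct] at hu'
    simpa [Matrix.mulVec_mulVec, h.transpose_mul, axis] using hu'
  · rintro ⟨hx, hx'⟩
    refine ⟨L.transpose.mulVec x, ⟨h.scales_dual_transpose.mulVec_mem hx, ?_⟩,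
      h.mulVec_transpose_mulVec x⟩
    rw [axis_dotProduct, axis_dotProduct]
    simpa [axis] using hx'

/-- The normal is `w = L e` and the point `v = M e`; they satisfy `wᵀv = 1` because `Lᵀ M = 1`. -/
theorem image_eq_truncCone (h : BlockScaling γ M L) :
    (fun x => M.mulVec x) '' truncCone (axis p) (axis p) =
      truncCone (L.mulVec (axis p)) (M.mulVec (axis p)) := by
  rw [h.image_eq]
  ext x
  have h1 : L.mulVec (axis p) ⬝ᵥ x = L.transpose.mulVec x 0 := by
    conv_lhs => rw [← h.mulVec_transpose_mulVec x]
    rw [h.dual_dotProduct, axis_dotProduct]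
  have h2 : L.mulVec (axis p) ⬝ᵥ M.mulVec (axis p) = 1 := by
    rw [h.dual_dotProduct, axis_dotProduct]; simp [axis]
  simp only [truncCone, Set.mem_ofPred_eq, h1, h2]

end BlockScaling

/-! ### Volume reduction and the two kinds of cuts. -/

theorem volume_image_mul_boost (M : Matrix (Fin (p + 1)) (Fin (p + 1)) ℝ) {c α b : ℝ}
    {β : Fin p → ℝ} (hc : 0 ≤ c) (hcb : c ≤ b) (hα : 0 < α) (hβ : α ^ 2 - ∑ a, β a ^ 2 = 1)
    (s : Set (Fin (p + 1) → ℝ)) :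
    MeasureTheory.volume ((fun x => (M * boost c α β).mulVec x) '' s) ≤
      ENNReal.ofReal (b ^ (p + 1)) * MeasureTheory.volume ((fun x => M.mulVec x) '' s) := by
  have key : ∀ N : Matrix (Fin (p + 1)) (Fin (p + 1)) ℝ,
      MeasureTheory.volume ((fun x => N.mulVec x) '' s) =
        ENNReal.ofReal |N.det| * MeasureTheory.volume s := fun N => by
    have := MeasureTheory.Measure.addHaar_image_linearMap MeasureTheory.volume
      (Matrix.toLin' N) s
    rw [LinearMap.det_toLin'] at this
    exact this
  rw [key, key, Matrix.det_mul, abs_mul, abs_det_boost hc hα hβ, mul_comm |M.det|,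
    ENNReal.ofReal_mul (by positivity), mul_assoc]
  gcongr

/-- `wᵀ x ≤ wᵀ v` is a nonnegative combination of `x₀ ≤ 1` and `yᵀ x ≤ y₀ / √2`, and the cut by
`w`, `v` shrinks volumes at least by the factor `0.96` per dimension. -/
structure CutVectors (y w v : Fin (p + 1) → ℝ) : Prop where
  head_pos : 0 < w 0
  lorentz_pos : 0 < lorentz w
  dot_pos : 0 < w ⬝ᵥ v
  dot_sq_le : (w ⬝ᵥ v) ^ 2 ≤ 0.96 ^ 2 * lorentz w
  comb : ∃ a b : ℝ, 0 ≤ a ∧ 0 < b ∧ w ⬝ᵥ v = a + b * (y 0 * (1 / √2)) ∧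
    ∀ x, w ⬝ᵥ x = a * x 0 + b * (y ⬝ᵥ x)

theorem inv_sqrt_two_bounds : 0 < 1 / √2 ∧ (1 / √2) ^ 2 = 1 / 2 ∧ 1 / √2 < 0.7072 ∧
    0.7071 < 1 / √2 := by
  have h0 : 0 < 1 / √2 := by positivity
  have h1 : (1 / √2) ^ 2 = 1 / 2 := by rw [div_pow, Real.sq_sqrt (by norm_num)]; norm_num
  refine ⟨h0, h1, ?_, ?_⟩ <;> nlinarith

theorem cutVectors_axis {y : Fin (p + 1) → ℝ} (hy : tailNorm y < y 0)
    (h : tailNorm y / y 0 ≤ 3 / 5) :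
    CutVectors y y (Fin.cons (α := fun _ => ℝ) (1 / √2) fun _ => 0) := by
  obtain ⟨h0, h1, h2, h3⟩ := inv_sqrt_two_bounds
  have hy0 : 0 < y 0 := (tailNorm_nonneg y).trans_lt hy
  have hv : y ⬝ᵥ (Fin.cons (α := fun _ => ℝ) (1 / √2) fun _ => 0) = y 0 * (1 / √2) := by
    rw [dotProduct_eq_head_add]; simp
  rw [div_le_iff₀ hy0] at h
  have hT : tailNorm y ^ 2 ≤ (3 / 5 * y 0) ^ 2 := by
    have := tailNorm_nonneg y
    gcongr
  refine ⟨hy0, (tailNorm_lt_iff.1 hy).2, ?_, ?_, 0, 1, le_rfl, one_pos, ?_, fun x => ?_⟩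
  · rw [hv]; positivity
  -- Here `lorentz y ≥ (1 - 0.6²) y₀² = 0.64 y₀²`, and `1/2 ≤ 0.96² · 0.64`.
  · rw [hv, mul_pow, h1, lorentz_eq]; nlinarith [sq_nonneg (y 0)]
  · rw [hv]; ring
  · ring

/-- With `k = 1/√2`, the choice `κ η² = 1 - k` makes `wᵀv` and `w₀² - ‖w₁‖²` equal, both being `1 -
κ(1 - k)`. The weights of the two inequalities are `1 - κ` and `κ / y₀`; `η > 0.6` ensures `κ ≤ 1`,
so that the first is nonnegative. -/
theorem cutVectors_oblique {y u : Fin (p + 1) → ℝ} (hy : tailNorm y < y 0) {η κ : ℝ}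
    (hη : η = tailNorm y / y 0) (h : 3 / 5 < η) (hκ : κ = (1 - 1 / √2) / (η * η))
    (hu : u = Fin.cons (α := fun _ => ℝ) 1 fun a => κ * (y a.succ / y 0)) :
    CutVectors y u (Fin.cons (α := fun _ => ℝ) 1 fun a => 0 - u a.succ) := by
  obtain ⟨h0, h1, h2, h3⟩ := inv_sqrt_two_bounds
  generalize hk : 1 / √2 = k at *
  have hy0 : 0 < y 0 := (tailNorm_nonneg y).trans_lt hy
  have hη1 : η < 1 := by rw [hη, div_lt_one hy0]; exact hy
  have hη2 : η * η * κ = 1 - k := by rw [hκ]; field_simp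
  have hκ0 : 0 < κ := by rw [hκ]; apply div_pos <;> nlinarith
  have hκ1 : κ ≤ 1 := by rw [hκ, div_le_one (by positivity)]; nlinarith
  have hsum : ∑ a : Fin p, u a.succ ^ 2 = κ * (1 - k) := by
    have : ∑ a : Fin p, u a.succ ^ 2 = κ ^ 2 * (tailNorm y ^ 2 / y 0 ^ 2) := by
      rw [tailNorm_sq, Finset.sum_div, Finset.mul_sum, hu]
      exact Finset.sum_congr rfl fun _ _ => by rw [Fin.cons_succ]; ring
    rw [this, ← div_pow, ← hη, ← hη2]; ring
  have hu0 : u 0 = 1 := by rw [hu]; rfl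
  have hl : lorentz u = 1 - κ * (1 - k) := by rw [lorentz, hsum, hu0]; ring
  have hd : u ⬝ᵥ (Fin.cons (α := fun _ => ℝ) 1 fun a => 0 - u a.succ) = 1 - κ * (1 - k) := by
    rw [dotProduct_eq_head_add, hu0, ← hsum]
    simp only [Fin.cons_zero, Fin.cons_succ, zero_sub, mul_neg, Finset.sum_neg_distrib, ← pow_two]
    ring
  -- From `η < 1`. It yields `1 - κ(1 - k) ≤ 1 - (1 - k)² < 0.96²`, the estimate that dictates the
  -- constant 0.96.
  have hκ2 : 1 - k ≤ κ := by
    rw [← hη2]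
    have : η * η ≤ 1 := by nlinarith
    nlinarith
  refine ⟨by rw [hu0]; exact one_pos, ?_, ?_, ?_, 1 - κ, κ / y 0, by linarith, by positivity,
    ?_, fun x => ?_⟩
  · rw [hl]; nlinarith
  · rw [hd]; nlinarith
  · have h5 : 0 ≤ 1 - κ * (1 - k) := by nlinarith
    have h6 : 1 - κ * (1 - k) ≤ 0.96 ^ 2 := by nlinarith
    rw [hd, hl]; nlinarith
  · rw [hd, hk]; field_simp; ring
  · rw [dotProduct_eq_head_add, dotProduct_eq_head_add, hu0, mul_add, Finset.mul_sum, hu]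
    have : ∑ a : Fin p, (Fin.cons (α := fun _ => ℝ) 1 (fun a => κ * (y a.succ / y 0)) :
        Fin (p + 1) → ℝ) a.succ * x a.succ = ∑ a : Fin p, κ / y 0 * (y a.succ * x a.succ) :=
      Finset.sum_congr rfl fun _ _ => by rw [Fin.cons_succ]; ring
    rw [this]; field_simp; ring

end Cone

open Prog

/-! ### Orthogonal projections -/

section Projection

variable {ι : Type} [Fintype ι]

/-- `P` is the matrix of the orthogonal projection along `V`. -/
structure IsProjAlong (P : Matrix ι ι ℝ) (V : Submodule ℝ (ι → ℝ)) : Prop where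
  symm : P.transpose = P
  apply_eq_zero : ∀ x ∈ V, P.mulVec x = 0
  sub_mem : ∀ x, x - P.mulVec x ∈ V

namespace IsProjAlong

variable {P : Matrix ι ι ℝ} {V : Submodule ℝ (ι → ℝ)}

theorem apply_apply (h : IsProjAlong P V) (x : ι → ℝ) : P.mulVec (P.mulVec x) = P.mulVec x := by
  have := h.apply_eq_zero _ (h.sub_mem x)
  rw [Matrix.mulVec_sub, sub_eq_zero] at this
  exact this.symm

theorem mem_of_apply_eq_zero (h : IsProjAlong P V) {x : ι → ℝ} (hx : P.mulVec x = 0) :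
    x ∈ V := by
  simpa [hx] using h.sub_mem x

theorem dot_comm (h : IsProjAlong P V) (x y : ι → ℝ) :
    P.mulVec x ⬝ᵥ y = x ⬝ᵥ P.mulVec y := by
  rw [Matrix.dotProduct_mulVec, ← Matrix.mulVec_transpose, h.symm]

theorem apply_dot_apply (h : IsProjAlong P V) (x y : ι → ℝ) :
    P.mulVec x ⬝ᵥ P.mulVec y = x ⬝ᵥ P.mulVec y := by
  rw [h.dot_comm, h.apply_apply]

theorem dot_eq_zero (h : IsProjAlong P V) {x : ι → ℝ} (hx : x ∈ V) (y : ι → ℝ) :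
    x ⬝ᵥ P.mulVec y = 0 := by
  rw [← h.dot_comm, h.apply_eq_zero x hx, zero_dotProduct]

theorem apply_dot_self_le (h : IsProjAlong P V) (x : ι → ℝ) :
    P.mulVec x ⬝ᵥ P.mulVec x ≤ x ⬝ᵥ x := by
  have h1 : 0 ≤ (x - P.mulVec x) ⬝ᵥ (x - P.mulVec x) :=
    Finset.sum_nonneg fun i _ => mul_self_nonneg _
  have h2 := h.apply_dot_apply x x
  rw [sub_dotProduct, dotProduct_sub, dotProduct_sub, dotProduct_comm (P.mulVec x) x] at h1
  linarith

theorem one [DecidableEq ι] : IsProjAlong (1 : Matrix ι ι ℝ) ⊥ :=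
  ⟨Matrix.transpose_one, by simp, by simp⟩

/-- The vector `v = P a` is the component of `a` orthogonal to `V`. Removing the direction `v`
leaves `V` annihilated, as `v ⊥ V`, and annihilates `a`, as `vᵀa = vᵀv`. -/
theorem rank_one_update (h : IsProjAlong P V) (a : ι → ℝ)
    (ha : P.mulVec a ⬝ᵥ P.mulVec a ≠ 0) :
    IsProjAlong (Matrix.of fun q q' => P q q' -
      P.mulVec a q * P.mulVec a q' / (P.mulVec a ⬝ᵥ P.mulVec a)) (V ⊔ Submodule.span ℝ {a}) := by
  set v := P.mulVec a with hv
  have happ : ∀ x, (Matrix.of fun q q' => P q q' - v q * v q' / (v ⬝ᵥ v)).mulVec x =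
      P.mulVec x - ((v ⬝ᵥ x) / (v ⬝ᵥ v)) • v := fun x => by
    funext q
    simp only [Matrix.mulVec, dotProduct, Matrix.of_apply, sub_mul, Finset.sum_sub_distrib,
      Pi.sub_apply, Pi.smul_apply, smul_eq_mul, Finset.sum_div, Finset.sum_mul]
    congr 1
    exact Finset.sum_congr rfl fun _ _ => by ring
  refine ⟨?_, fun x hx => ?_, fun x => ?_⟩
  · ext q q'
    have : P q' q = P q q' := congrFun (congrFun h.symm q) q'
    simp only [Matrix.transpose_apply, Matrix.of_apply, this, mul_comm (v q')]
  · obtain ⟨y, hy, w, hw, rfl⟩ := Submodule.mem_sup.1 hx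
    obtain ⟨c, rfl⟩ := Submodule.mem_span_singleton.1 hw
    have h1 : v ⬝ᵥ y = 0 := by rw [dotProduct_comm]; exact h.dot_eq_zero hy a
    have h2 : v ⬝ᵥ a = v ⬝ᵥ v := by rw [hv, h.apply_dot_apply, dotProduct_comm]
    rw [happ, Matrix.mulVec_add, h.apply_eq_zero y hy, Matrix.mulVec_smul, dotProduct_add, h1,
      dotProduct_smul, h2, ← hv, zero_add, zero_add, smul_eq_mul, mul_div_cancel_right₀ _ ha,
      sub_self]
  · have hvm : v ∈ V ⊔ Submodule.span ℝ {a} := by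
      have : v = a - (a - P.mulVec a) := by rw [hv]; abel
      rw [this]
      exact Submodule.sub_mem _ (Submodule.mem_sup_right (Submodule.mem_span_singleton_self a))
        (Submodule.mem_sup_left (h.sub_mem a))
    rw [happ, ← sub_add]
    exact Submodule.add_mem _ (Submodule.mem_sup_left (h.sub_mem x))
      (Submodule.smul_mem _ _ hvm)

end IsProjAlong

end Projection

theorem dotProduct_self_pos {ι : Type} [Fintype ι] {x : ι → ℝ} (hx : x ≠ 0) : 0 < x ⬝ᵥ x :=
  lt_of_le_of_ne (Finset.sum_nonneg fun _ _ => mul_self_nonneg _)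
    fun h => hx (dotProduct_self_eq_zero.1 h.symm)

/-! ### The basic procedure: projection, separators, descent and cost. -/

section BasicProcedure

variable {n m : ℕ} {r : Fin n → ℕ}

theorem one_le_sum_dims (hn : 0 < n) (r : Fin n → ℕ) : 1 ≤ ∑ i, (r i + 1) :=
  (Nat.le_add_left 1 (r ⟨0, hn⟩)).trans
    (Finset.single_le_sum (f := fun i => r i + 1) (fun _ _ => Nat.zero_le _) (Finset.mem_univ _))

theorem projection_spec (hn : 0 < n) {A : Fin m → Idx r → ℝ} (hA : LinearIndependent ℝ A) :
    Spec (projection A) (fun P => IsProjAlong (Matrix.of P) (Submodule.span ℝ (Set.range A)))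
      (2 + m * (9 * (∑ i, (r i + 1)) ^ 2)) := by
  have hN1 := one_le_sum_dims hn r
  set N := ∑ i, (r i + 1) with hN
  refine Spec.le (Spec.lit_zero.bind_eq <| Spec.lit_one.bind_eq <| Spec.imp
    (Spec.iter_prefix (N := 9 * N ^ 2) (Inv := fun pre P =>
      IsProjAlong (Matrix.of P) (Submodule.span ℝ (A '' {j | j ∈ pre}))) ?_ ?_) ?_) ?_
  · intro pre j post P hl hP
    have hj : j ∉ pre := by
      have := List.nodup_finRange m
      rw [hl, List.nodup_append] at this
      exact fun h => this.2.2 j h j (by simp) rfl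
    -- If the projected row vanished, it would lie in the span of the rows already processed.
    have hv : (Matrix.of P).mulVec (A j) ⬝ᵥ (Matrix.of P).mulVec (A j) ≠ 0 := by
      intro h0
      exact hA.notMem_span_image (s := {j | j ∈ pre}) (x := j) hj
        (hP.mem_of_apply_eq_zero (dotProduct_self_eq_zero.1 h0))
    refine Spec.le (Spec.imp ((Spec.fill_idx _ fun q => Spec.dot_idx (P q) (A j)).bind_eq <|
      (Spec.dot_idx _ _).bind_eq <| Spec.fill_idx _ fun q => Spec.fill_idx _ fun q' =>
        (Spec.mul _ _).bind_eq <| (Spec.div _ hv).bind_eq <| Spec.sub _ _) ?_) ?_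
    · rintro _ rfl
      have h := hP.rank_one_update (A j) hv
      have hset : A '' {i | i ∈ pre ++ [j]} = A '' {i | i ∈ pre} ∪ {A j} := by
        ext x
        simp only [List.mem_append, List.mem_singleton, Set.mem_image, Set.mem_ofPred_eq,
          Set.mem_union, Set.mem_singleton_iff]
        constructor
        · rintro ⟨i, hi | rfl, rfl⟩
          · exact Or.inl ⟨i, hi, rfl⟩
          · exact Or.inr rfl
        · rintro (⟨i, hi, rfl⟩ | rfl)
          · exact ⟨i, Or.inl hi, rfl⟩
          · exact ⟨j, Or.inr rfl, rfl⟩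
      rw [hset, Submodule.span_union]
      exact h
    · rw [← hN]
      nlinarith [hN1]
  · have h := IsProjAlong.one (ι := Idx r)
    have hset : A '' {j | j ∈ ([] : List (Fin m))} = ∅ := by simp
    rw [hset, Submodule.span_empty]
    exact h
  · intro P hP
    have hset : A '' {j | j ∈ List.finRange m} = Set.range A := by simp
    rwa [hset] at hP
  · rw [List.length_finRange]; omega

theorem dotProduct_eq_sum_blk (x y : Idx r → ℝ) : x ⬝ᵥ y = ∑ i, blk x i ⬝ᵥ blk y i :=
  Fintype.sum_sigma _

theorem tail_dot_tail {p : ℕ} (x : Fin (p + 1) → ℝ) :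
    ((fun a : Fin p => x a.succ) ⬝ᵥ fun a => x a.succ) = ∑ a : Fin p, x a.succ ^ 2 :=
  Finset.sum_congr rfl fun _ _ => (pow_two _).symm

theorem tailSq_spec {p : ℕ} (x : Fin (p + 1) → ℝ) :
    Spec (tailSq x) (· = ∑ a : Fin p, x a.succ ^ 2) (1 + p * 2) := by
  rw [← tail_dot_tail]
  exact Spec.dot_fin _ _

theorem badBlocks_spec {d : ℕ} (hd : ∀ i, r i + 1 ≤ d) (z : Idx r → ℝ) :
    Spec (badBlocks z) (fun l => ∀ i, i ∈ l ↔ blk z i 0 ≤ tailNorm (blk z i))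
      (n * (2 * d + 1)) := by
  have : Spec (badBlocks z)
      (fun l => ∀ i, i ∈ l ↔ i ∈ List.finRange n ∧ blk z i 0 ≤ tailNorm (blk z i))
      ((List.finRange n).length * (2 * d + 1)) := by
    refine Spec.select fun i _ => ?_
    refine Spec.le ((tailSq_spec (blk z i)).bind_eq <|
      (Spec.sqrt (sum_sq_tail_nonneg (blk z i))).bind_eq <|
        Spec.comp_le (blk z i 0) (tailNorm (blk z i))) ?_
    have := hd i
    omega
  simpa [List.length_finRange] using this

/-- For `z₀ > 0` the vector is `(1; -z₁/‖z₁‖)`, on the boundary of the cone, and its product with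
`z` is `z₀ - ‖z₁‖ ≤ 0`. The division is legal because `‖z₁‖ ≥ z₀ > 0`. -/
theorem separator_spec {p : ℕ} {z : Fin (p + 1) → ℝ} (hz : z 0 ≤ tailNorm z) :
    Spec (separator z) (fun η => η 0 = 1 ∧ η ∈ soc p ∧ η ⬝ᵥ z ≤ 0) (5 + p * 5) := by
  refine Spec.le (Spec.lit_zero.bind_eq <| Spec.lit_one.bind_eq <|
    (Spec.comp_le (z 0) 0).bind fun b hb => Spec.ite (N₁ := 0) (N₂ := 2 + p * 5)
      (fun h => Spec.ret ?_) fun h => ?_) (by omega)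
  · refine ⟨rfl, mem_soc_iff.2 ⟨by simp, by simp [lorentz]⟩, ?_⟩
    rw [dotProduct_eq_head_add]
    simpa using hb.1 h
  · have hz0 : 0 < z 0 := not_le.1 fun h' => h (hb.2 h')
    set u : Fin p → ℝ := fun a => z a.succ / z 0 with hu
    have hq : u ⬝ᵥ u = (∑ a : Fin p, z a.succ ^ 2) / z 0 ^ 2 := by
      rw [Finset.sum_div]
      exact Finset.sum_congr rfl fun _ _ => by rw [hu]; ring
    have hq1 : 1 ≤ u ⬝ᵥ u := by
      rw [hq, one_le_div (by positivity), ← tailNorm_sq]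
      gcongr
    have ht1 : 1 ≤ √(u ⬝ᵥ u) := Real.one_le_sqrt.2 hq1
    have htt : √(u ⬝ᵥ u) ^ 2 = u ⬝ᵥ u := Real.sq_sqrt (by linarith)
    refine Spec.le ((Spec.fill_fin _ fun a => Spec.div (z a.succ) hz0.ne').bind_eq <|
      (Spec.dot_fin u u).bind_eq <| (Spec.sqrt (by linarith)).bind_eq <|
      (Spec.fill_fin _ fun a => (Spec.div (u a) (by positivity)).bind_eq <|
        Spec.sub 0 _).bind_eq <| Spec.ret ?_) (by omega)
    set t := √(u ⬝ᵥ u) with ht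
    refine ⟨rfl, mem_soc_iff.2 ⟨by simp, le_of_eq ?_⟩, ?_⟩
    · have : ∑ a, (0 - u a / t) ^ 2 = (u ⬝ᵥ u) / t ^ 2 := by
        rw [dotProduct, Finset.sum_div]
        exact Finset.sum_congr rfl fun _ _ => by ring
      simp only [lorentz, Fin.cons_zero, Fin.cons_succ]
      rw [this, htt, div_self (by linarith)]; norm_num
    · rw [dotProduct_eq_head_add]
      have : ∑ a : Fin p, (0 - u a / t) * z a.succ = -(z 0 * (u ⬝ᵥ u) / t) := by
        rw [dotProduct, Finset.mul_sum, Finset.sum_div, ← Finset.sum_neg_distrib]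
        refine Finset.sum_congr rfl fun a _ => ?_
        have : z a.succ = u a * z 0 := by rw [hu]; field_simp
        rw [this]; ring
      simp only [Fin.cons_zero, Fin.cons_succ]
      rw [this, ← htt]
      have : z 0 * t ^ 2 / t = z 0 * t := by field_simp
      rw [this]; nlinarith

/-- What the basic procedure promises about its output; `V` is the row space of its matrix. -/
def BPOut.Correct (V : Submodule ℝ (Idx r → ℝ)) : BPOut ℝ r → Prop
  | .primal x => (∀ s ∈ V, s ⬝ᵥ x = 0) ∧ ∀ i, tailNorm (blk x i) < blk x i 0
  | .dual y => y ∈ V ∧ y ∈ prodCone r ∧ y ≠ 0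
  | .cut y k => (∀ i, tailNorm (blk y i) < blk y i 0) ∧
      ∃ z : Idx r → ℝ, 0 < z ⬝ᵥ z ∧ 2 * √n * √(z ⬝ᵥ z) ≤ blk y k 0 ∧
        ∀ x, (∀ s ∈ V, s ⬝ᵥ x = 0) → y ⬝ᵥ x = z ⬝ᵥ x

/-- The invariant of the basic procedure after `t` iterations. -/
structure BPInv (P : Idx r → Idx r → ℝ) (t : ℕ) (yz : (Idx r → ℝ) × (Idx r → ℝ)) : Prop where
  interior : ∀ i, tailNorm (blk yz.1 i) < blk yz.1 i 0
  sum_eq : ∑ i, blk yz.1 i 0 = 1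
  proj : yz.2 = (Matrix.of P).mulVec yz.1
  bound : (yz.2 ⬝ᵥ yz.2) * t ≤ 2

/-- Some head is at least `1/n`, since the heads sum to 1; and `t ≥ 8n³` turns the descent bound
into `4n ‖z‖² ≤ 1/n²`. -/
theorem BPInv.exists_cut {P : Idx r → Idx r → ℝ} {t : ℕ} {yz : (Idx r → ℝ) × (Idx r → ℝ)}
    (h : BPInv P t yz) (hn : 0 < n) (ht : 8 * n ^ 3 ≤ t) :
    ∃ k, 2 * √n * √(yz.2 ⬝ᵥ yz.2) ≤ blk yz.1 k 0 := by
  have hn' : (0 : ℝ) < n := by exact_mod_cast hn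
  have : Nonempty (Fin n) := ⟨⟨0, hn⟩⟩
  obtain ⟨k, -, hk⟩ : ∃ k ∈ (Finset.univ : Finset (Fin n)), (1 : ℝ) / n ≤ blk yz.1 k 0 := by
    refine Finset.exists_le_of_sum_le Finset.univ_nonempty ?_
    rw [h.sum_eq]
    simp [hn'.ne']
  refine ⟨k, le_trans ?_ hk⟩
  have hz : 0 ≤ yz.2 ⬝ᵥ yz.2 := Finset.sum_nonneg fun _ _ => mul_self_nonneg _
  have ht' : (8 : ℝ) * n ^ 3 ≤ t := by exact_mod_cast ht
  have h1 : (yz.2 ⬝ᵥ yz.2) * (8 * n ^ 3) ≤ 2 := (mul_le_mul_of_nonneg_left ht' hz).trans h.bound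
  refine abs_le_of_sq_le_sq' ?_ (by positivity) |>.2
  rw [mul_pow, mul_pow, Real.sq_sqrt hn'.le, Real.sq_sqrt hz, div_pow, one_pow,
    le_div_iff₀ (by positivity)]
  nlinarith

/-- The minimum of `‖αz + (1-α)p‖²` is `(pp·zz - pz²)/‖p - z‖²`, at most `pp·zz/(pp + zz)` when `pz
≤ 0`. Hence its reciprocal is at least `1/zz + 1/pp ≥ t/2 + 1/2`. Strict positivity of `α` keeps `y`
in the interior although `η` may be on the boundary. -/
theorem segment_min_bound {zz pz pp t : ℝ} (hz : 0 < zz) (hp : 0 < pp) (hpz : pz ≤ 0)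
    (hp2 : pp ≤ 2) (ht : 0 ≤ t) (hzt : zz * t ≤ 2) {α : ℝ}
    (hα : α = (pp - pz) / (pp - 2 * pz + zz)) :
    0 < α ∧ 0 ≤ 1 - α ∧
      (α ^ 2 * zz + 2 * α * (1 - α) * pz + (1 - α) ^ 2 * pp) * (t + 1) ≤ 2 := by
  have hD : 0 < pp - 2 * pz + zz := by linarith
  have hα' : α * (pp - 2 * pz + zz) = pp - pz := by rw [hα, div_mul_cancel₀ _ hD.ne']
  refine ⟨by rw [hα]; apply div_pos <;> linarith, ?_, ?_⟩
  · rw [hα, sub_nonneg, div_le_one hD]; linarith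
  · have h1 : α ^ 2 * zz + 2 * α * (1 - α) * pz + (1 - α) ^ 2 * pp =
        (pp * zz - pz ^ 2) / (pp - 2 * pz + zz) := by
      rw [eq_div_iff hD.ne']
      linear_combination (α * (pp - 2 * pz + zz) - (pp - pz)) * hα'
    rw [h1, div_mul_eq_mul_div, div_le_iff₀ hD]
    nlinarith [mul_nonneg hp.le (sub_nonneg.2 hzt), mul_nonneg hz.le (sub_nonneg.2 hp2),
      mul_nonneg (sq_nonneg pz) ht, sq_nonneg pz]

theorem blk_setBlk_self (x : Idx r → ℝ) (k : Fin n) (b : Fin (r k + 1) → ℝ) :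
    blk (setBlk x k b) k = b := by
  funext a
  change Function.update (fun i => blk x i) k b k a = b a
  rw [Function.update_self]

theorem blk_setBlk_of_ne (x : Idx r → ℝ) {i k : Fin n} (h : i ≠ k) (b : Fin (r k + 1) → ℝ) :
    blk (setBlk x k b) i = blk x i := by
  funext a
  change Function.update (fun i => blk x i) k b i a = blk x i a
  rw [Function.update_of_ne h]

theorem setBlk_zero_dotProduct (k : Fin n) (b : Fin (r k + 1) → ℝ) (x : Idx r → ℝ) :
    setBlk (fun _ => 0) k b ⬝ᵥ x = b ⬝ᵥ blk x k := by
  rw [dotProduct_eq_sum_blk, Finset.sum_eq_single k, blk_setBlk_self]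
  · intro i _ hi
    rw [blk_setBlk_of_ne _ hi]
    exact zero_dotProduct _
  · simp

theorem setBlk_zero_mem_prodCone {k : Fin n} {b : Fin (r k + 1) → ℝ} (hb : b ∈ soc (r k)) :
    setBlk (fun _ => 0) k b ∈ prodCone r := by
  intro i
  by_cases hi : i = k
  · subst hi; rwa [blk_setBlk_self]
  · rw [blk_setBlk_of_ne _ hi]
    exact mem_soc_iff.2 ⟨by simp [blk], by simp [blk, lorentz]⟩

theorem separator_dot_self_le {p : ℕ} {η : Fin (p + 1) → ℝ} (h0 : η 0 = 1) (h : η ∈ soc p) :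
    η ⬝ᵥ η ≤ 2 := by
  have h1 := (mem_soc_iff.1 h).2
  rw [lorentz, h0] at h1
  rw [dotProduct_eq_head_add, h0]
  simp only [← pow_two]
  linarith

theorem BPInv.next {P : Idx r → Idx r → ℝ} {V : Submodule ℝ (Idx r → ℝ)}
    (hP : IsProjAlong (Matrix.of P) V) {t : ℕ} {y z : Idx r → ℝ} (h : BPInv P t (y, z))
    (hz : 0 < z ⬝ᵥ z) {i : Fin n} {b : Fin (r i + 1) → ℝ} (hb0 : b 0 = 1) (hb : b ∈ soc (r i))
    (hbz : b ⬝ᵥ blk z i ≤ 0) {p : Idx r → ℝ}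
    (hp : p = (Matrix.of P).mulVec (setBlk (fun _ => 0) i b)) (hpp : 0 < p ⬝ᵥ p) {α : ℝ}
    (hα : α = p ⬝ᵥ (fun q => p q - z q) / ((fun q => p q - z q) ⬝ᵥ fun q => p q - z q)) :
    BPInv P (t + 1) (fun q => α * y q + (1 - α) * setBlk (fun _ => 0) i b q,
      fun q => α * z q + (1 - α) * p q) := by
  set η := setBlk (fun _ => (0 : ℝ)) i b with hη
  have hηz : p ⬝ᵥ z ≤ 0 := by
    have hzP : z = (Matrix.of P).mulVec y := h.proj
    rw [hp, hzP, hP.apply_dot_apply, ← hzP, hη, setBlk_zero_dotProduct]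
    exact hbz
  have hpp2 : p ⬝ᵥ p ≤ 2 := by
    rw [hp]
    refine (hP.apply_dot_self_le η).trans ?_
    rw [hη, setBlk_zero_dotProduct, blk_setBlk_self]
    exact separator_dot_self_le hb0 hb
  have hnum : p ⬝ᵥ (fun q => p q - z q) = p ⬝ᵥ p - p ⬝ᵥ z := dotProduct_sub p p z
  have hden : ((fun q => p q - z q) ⬝ᵥ fun q => p q - z q) =
      p ⬝ᵥ p - 2 * (p ⬝ᵥ z) + z ⬝ᵥ z := by
    change (p - z) ⬝ᵥ (p - z) = _
    rw [sub_dotProduct, dotProduct_sub, dotProduct_sub, dotProduct_comm z p]; ring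
  obtain ⟨ha, ha', hbound⟩ := segment_min_bound hz hpp hηz hpp2 (Nat.cast_nonneg t) h.bound
    (hα.trans (by rw [hnum, hden]))
  have hyη : (fun q => α * y q + (1 - α) * η q) = α • y + (1 - α) • η := rfl
  have hzp : (fun q => α * z q + (1 - α) * p q) = α • z + (1 - α) • p := rfl
  have hηcone : η ∈ prodCone r := setBlk_zero_mem_prodCone hb
  have hηsum : ∑ j, blk η j 0 = 1 := by
    rw [Finset.sum_eq_single i, hη, blk_setBlk_self, hb0]
    · intro j _ hj
      rw [hη, blk_setBlk_of_ne _ hj]; rfl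
    · simp
  refine ⟨fun j => ?_, ?_, ?_, ?_⟩
  · have h1 := tailNorm_comb_le ha.le ha' (blk y j) (blk η j)
    have h2 : tailNorm (blk y j) < blk y j 0 := h.interior j
    have h3 : tailNorm (blk η j) ≤ blk η j 0 := hηcone j
    calc tailNorm (α • blk y j + (1 - α) • blk η j) ≤ _ := h1
      _ < α * blk y j 0 + (1 - α) * blk η j 0 :=
        add_lt_add_of_lt_of_le (mul_lt_mul_of_pos_left h2 ha) (mul_le_mul_of_nonneg_left h3 ha')
  · have h1 : ∑ j, blk y j 0 = 1 := h.sum_eq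
    calc ∑ j, (α * blk y j 0 + (1 - α) * blk η j 0) = _ := Finset.sum_add_distrib
      _ = 1 := by rw [← Finset.mul_sum, ← Finset.mul_sum, h1, hηsum]; ring
  · have h1 : z = (Matrix.of P).mulVec y := h.proj
    dsimp only
    rw [hyη, hzp, Matrix.mulVec_add, Matrix.mulVec_smul, Matrix.mulVec_smul, ← h1, ← hp]
  · dsimp only
    rw [hzp]
    refine le_trans (le_of_eq ?_) hbound
    simp only [add_dotProduct, dotProduct_add, smul_dotProduct, dotProduct_smul, smul_eq_mul,
      dotProduct_comm z p]
    push_cast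
    ring

theorem bpBody_spec (hn : 0 < n) {d : ℕ} (hd : ∀ i, r i + 1 ≤ d) {V : Submodule ℝ (Idx r → ℝ)}
    {P : Idx r → Idx r → ℝ} (hP : IsProjAlong (Matrix.of P) V) {t : ℕ}
    {yz : (Idx r → ℝ) × (Idx r → ℝ)} (h : BPInv P t yz) :
    Spec (bpBody P yz)
      (Sum.elim (fun yz' => t < 8 * n ^ 3 ∧ BPInv P (t + 1) yz') (BPOut.Correct V))
      (60 * ((∑ i, (r i + 1)) * d)) := by
  obtain ⟨y, z⟩ := yz
  set N := ∑ i, (r i + 1) with hN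
  have hy : ∀ i, tailNorm (blk y i) < blk y i 0 := h.interior
  have hzP : z = (Matrix.of P).mulVec y := h.proj
  have hkerP : ∀ x : Idx r → ℝ, ∀ s ∈ V, s ⬝ᵥ (Matrix.of P).mulVec x = 0 :=
    fun x s hs => hP.dot_eq_zero hs x
  have hd1 : 1 ≤ d := (Nat.le_add_left 1 _).trans (hd ⟨0, hn⟩)
  have hnN : n ≤ N := by
    calc n = ∑ _i : Fin n, 1 := by simp
      _ ≤ N := Finset.sum_le_sum fun i _ => Nat.le_add_left 1 (r i)
  have hN1 := one_le_sum_dims hn r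
  have e1 : N ≤ N * d := Nat.le_mul_of_pos_right _ hd1
  have e2 : d ≤ N * d := Nat.le_mul_of_pos_left _ hN1
  have e3 : n * (2 * d + 1) ≤ 3 * (N * d) := by
    calc n * (2 * d + 1) ≤ N * (3 * d) := Nat.mul_le_mul hnN (by omega)
      _ = _ := by ring
  have e4 : ∀ i, N * (1 + (r i + 1) * 2) ≤ 3 * (N * d) := fun i => by
    calc N * (1 + (r i + 1) * 2) ≤ N * (3 * d) := Nat.mul_le_mul_left _ (by have := hd i; omega)
      _ = _ := by ring
  unfold bpBody
  dsimp only
  refine Spec.le (Spec.lit_zero.bind_eq <| Spec.lit_one.bind_eq <|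
    (Spec.dot_idx z z).bind_eq <| (Spec.comp_le _ _).bind fun zIsZero hzz =>
    Spec.ite (N₁ := 0) (N₂ := 50 * (N * d)) (fun h0 => Spec.ret ?_) fun h0 => ?_) ?_
  · have hz0 : z = 0 := by
      by_contra hne
      exact (dotProduct_self_pos hne).not_ge (hzz.1 h0)
    refine ⟨hP.mem_of_apply_eq_zero (hzP ▸ hz0), fun i => (hy i).le, fun hy0 => ?_⟩
    have := hy ⟨0, hn⟩
    rw [hy0] at this
    exact (tailNorm_nonneg _).not_gt this
  · have hzz0 : 0 < z ⬝ᵥ z := not_le.1 fun h' => h0 (hzz.2 h')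
    refine Spec.le ((badBlocks_spec hd z).bind fun bad hbad =>
      Spec.ite (N₁ := 0) (N₂ := 46 * (N * d)) (fun hb => Spec.ret ?_) fun hb => ?_) (by omega)
    · rw [List.isEmpty_iff] at hb
      refine ⟨by rw [hzP]; exact hkerP y, fun i => not_le.1 fun hi => ?_⟩
      simpa [hb] using (hbad i).2 hi
    · have hbad0 : bad ≠ [] := fun h' => hb (by rw [h']; rfl)
      refine Spec.le ((Spec.lit 2).bind_eq <| (Spec.lit n).bind_eq <|
        (Spec.sqrt (Nat.cast_nonneg n)).bind_eq <| (Spec.sqrt hzz0.le).bind_eq <|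
        (Spec.mul _ _).bind_eq <| (Spec.mul _ _).bind_eq <|
        (Spec.select (T := fun k => 2 * √n * √(z ⬝ᵥ z) ≤ blk y k 0) (N := 1) fun k _ =>
          Spec.comp_le _ _).bind fun cuts hcuts =>
        Spec.ite (N₁ := 38 * (N * d)) (N₂ := 0) (fun hc => ?_) fun hc => ?_) ?_
      · rw [List.isEmpty_iff] at hc
        -- No cut was available, so the descent cannot have lasted `8n³` steps; this makes the
        -- variant of the loop decrease.
        have ht : t < 8 * n ^ 3 := by
          by_contra! h'
          obtain ⟨k, hk⟩ := h.exists_cut hn h'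
          simpa [hc] using (hcuts k).2 ⟨List.mem_finRange k, hk⟩
        refine Spec.le ((Spec.choose hbad0).bind (N₂ := 38 * (N * d)) fun i hi => ?_) (by omega)
        refine Spec.le ((separator_spec ((hbad i).1 hi)).bind (N₂ := 28 * (N * d))
          fun b hb => ?_) (by have := hd i; omega)
        obtain ⟨hb0, hbs, hbz⟩ := hb
        have hPη : ∀ q, (fun a => P q ⟨i, a⟩) ⬝ᵥ b =
            (Matrix.of P).mulVec (setBlk (fun _ => 0) i b) q := fun q => by
          change _ = P q ⬝ᵥ setBlk (fun _ => 0) i b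
          rw [dotProduct_comm (P q), setBlk_zero_dotProduct, dotProduct_comm]; rfl
        refine Spec.le ((Spec.fill_idx _ fun q => (Spec.dot_fin _ b).imp fun _ ha =>
          ha.trans (hPη q)).bind_eq (N₂ := 25 * (N * d)) ?_) (by have := e4 i; rw [← hN]; omega)
        generalize hp : (Matrix.of P).mulVec (setBlk (fun _ => 0) i b) = p
        refine Spec.le ((Spec.dot_idx p p).bind_eq <| (Spec.comp_le _ _).bind fun pz hpz =>
          Spec.ite (N₁ := 0) (N₂ := 20 * (N * d)) (fun h1 => Spec.ret ?_) fun h1 => ?_)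
          (by omega)
        · have hp0 : p = 0 := by
            by_contra hne
            exact (dotProduct_self_pos hne).not_ge (hpz.1 h1)
          refine ⟨hP.mem_of_apply_eq_zero (hp.trans hp0), setBlk_zero_mem_prodCone hbs,
            fun h2 => ?_⟩
          have h3 := congrFun (blk_setBlk_self (fun _ => 0) i b) 0
          rw [h2, hb0] at h3
          exact zero_ne_one h3
        · have hpp : 0 < p ⬝ᵥ p := not_le.1 fun h' => h1 (hpz.2 h')
          refine Spec.le ((badBlocks_spec hd p).bind fun bad' hbad' =>
            Spec.ite (N₁ := 0) (N₂ := 17 * (N * d)) (fun hb => Spec.ret ?_) fun hb => ?_)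
            (by omega)
          · rw [List.isEmpty_iff] at hb
            refine ⟨by rw [← hp]; exact hkerP _, fun j => not_le.1 fun hj => ?_⟩
            simpa [hb] using (hbad' j).2 hj
          -- If `p = z`, then `‖z‖² = pᵀz ≤ 0`, although `z ≠ 0`.
          · have hw : ((fun q => p q - z q) ⬝ᵥ fun q => p q - z q) ≠ 0 := by
              intro h2
              have h3 : p = z := by
                have := dotProduct_self_eq_zero.1 h2
                exact sub_eq_zero.1 this
              have h4 : p ⬝ᵥ z ≤ 0 := by
                rw [← hp, hP.dot_comm, hzP, hP.apply_apply, ← hzP, setBlk_zero_dotProduct]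
                exact hbz
              rw [h3] at h4
              exact hzz0.not_ge h4
            refine Spec.le ((Spec.fill_idx _ fun q => Spec.sub _ _).bind_eq <|
              (Spec.dot_idx p _).bind_eq <| (Spec.dot_idx _ _).bind_eq <|
              (Spec.div _ hw).bind_eq <| (Spec.sub _ _).bind_eq <|
              (Spec.fill_idx _ fun q => (Spec.mul _ _).bind_eq <| (Spec.mul _ _).bind_eq <|
                Spec.add _ _).bind_eq <|
              (Spec.fill_idx _ fun q => (Spec.mul _ _).bind_eq <| (Spec.mul _ _).bind_eq <|
                Spec.add _ _).bind_eq <| Spec.ret ?_) (by omega)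
            exact ⟨ht, h.next hP hzz0 hb0 hbs hbz hp.symm hpp rfl⟩
      · have hcuts0 : cuts ≠ [] := fun h' => hc (by rw [h']; rfl)
        refine Spec.le ((Spec.choose hcuts0).bind fun k hk => Spec.ret ?_) le_rfl
        -- `y - z = y - P y` lies in `V`, so `y` and `z` have the same product with every vector
        -- orthogonal to `V`.
        refine ⟨hy, z, hzz0, ((hcuts k).1 hk).2, fun x hx => ?_⟩
        have := hx _ (hP.sub_mem y)
        rw [← hzP, sub_dotProduct] at this
        linarith
      · rw [List.length_finRange]; omega
  · omega

theorem basicProcedure_spec (hn : 0 < n) {d : ℕ} (hd : ∀ i, r i + 1 ≤ d)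
    {A : Fin m → Idx r → ℝ} (hA : LinearIndependent ℝ A) {y : Idx r → ℝ}
    (hy : ∀ i, tailNorm (blk y i) < blk y i 0) (hsum : ∑ i, blk y i 0 = 1) :
    Spec (basicProcedure A y) (BPOut.Correct (Submodule.span ℝ (Set.range A)))
      (550 * (n ^ 3 * ((∑ i, (r i + 1)) * d) + m * (∑ i, (r i + 1)) ^ 2)) := by
  have hN1 := one_le_sum_dims hn r
  have hNn : ∑ i, (r i + 1) ≤ n * d := by
    calc ∑ i, (r i + 1) ≤ ∑ _i : Fin n, d := Finset.sum_le_sum fun i _ => hd i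
      _ = n * d := by simp
  set N := ∑ i, (r i + 1) with hN
  have hn3 : 1 ≤ n ^ 3 := Nat.one_le_pow _ _ hn
  have hX : N * d ≤ n ^ 3 * (N * d) := Nat.le_mul_of_pos_left _ hn3
  have hNd : 1 ≤ N * d :=
    Nat.mul_pos hN1 ((Nat.le_add_left 1 _).trans (hd ⟨0, hn⟩))
  -- The initial product `P y` is quadratic in `N`; it is absorbed by the cost of the loop because
  -- `N ≤ n d`.
  have hNN : N * (1 + N * 2) ≤ 3 * (n ^ 3 * (N * d)) := by
    calc N * (1 + N * 2) ≤ N * (3 * (n * d)) := Nat.mul_le_mul_left _ (by omega)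
      _ = 3 * (n * (N * d)) := by ring
      _ ≤ _ := by gcongr; exact Nat.le_self_pow (by norm_num) n
  refine Spec.le ((projection_spec hn hA).bind fun P hP => Spec.lit_zero.bind_eq <|
    (Spec.fill_idx _ fun q => Spec.dot_idx (P q) y).bind_eq
      (N₂ := (8 * n ^ 3 + 1) * (60 * (N * d))) ?_) ?_
  -- The variant is `8n³ - t`, with `t` the number of iterations done.
  · have := Spec.loop (K := 0) (N := 60 * (N * d)) (body := bpBody P)
      (Q := BPOut.Correct (Submodule.span ℝ (Set.range A)))
      (Inv := fun k yz => ∃ t, t + k = 8 * n ^ 3 ∧ BPInv P t yz) (fun k yz hk => by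
        obtain ⟨t, ht, hinv⟩ := hk
        refine (bpBody_spec hn hd hP hinv).imp ?_
        rintro (yz' | out) hout
        · exact ⟨k - 1, by have := hout.1; omega, t + 1, by have := hout.1; omega, hout.2⟩
        · exact hout) (8 * n ^ 3)
      (y, fun q => P q ⬝ᵥ y) ⟨0, by omega, hy, hsum, rfl, by simp⟩
    rwa [mul_zero] at this
  · have : (8 * n ^ 3 + 1) * (60 * (N * d)) = 480 * (n ^ 3 * (N * d)) + 60 * (N * d) := by ring
    have h9 : m * (9 * N ^ 2) = 9 * (m * N ^ 2) := by ring
    rw [this, h9, ← hN]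
    omega

end BasicProcedure

/-! ### From a cut generating block to its automorphism. -/

section Rescaling

variable {p : ℕ}

theorem applyAut_spec (c : ℝ) {α : ℝ} (hα : 0 < α) (β : Fin p → ℝ) (x : Fin (p + 1) → ℝ) :
    Spec (applyAut c α β x) (· = (boost c α β).mulVec x) (7 * (p + 1)) := by
  have h1 : 1 + α ≠ 0 := by positivity
  refine Spec.le (Spec.lit_one.bind_eq <| (Spec.dot_fin _ _).bind_eq <| (Spec.add _ _).bind_eq <|
    (Spec.div _ h1).bind_eq <| (Spec.mul _ _).bind_eq <| (Spec.sub _ _).bind_eq <|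
    (Spec.mul _ _).bind_eq <| (Spec.fill_fin _ fun a => (Spec.sub _ _).bind_eq <|
      (Spec.mul _ _).bind_eq <| (Spec.add _ _).bind_eq <| Spec.mul _ _).bind_eq <|
    Spec.ret (boost_mulVec c α β x).symm) (by omega)

theorem cutPair_spec {y : Fin (p + 1) → ℝ} (hy : tailNorm y < y 0) :
    Spec (cutPair y) (fun wv => CutVectors y wv.1 wv.2) (16 * (p + 1)) := by
  have hy0 : 0 < y 0 := (tailNorm_nonneg y).trans_lt hy
  refine Spec.le (Spec.lit_zero.bind_eq <| Spec.lit_one.bind_eq <| (Spec.lit 2).bind_eq <|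
    (Spec.lit 3).bind_eq <| (Spec.lit 5).bind_eq <| (Spec.div _ (by norm_num)).bind_eq <|
    (Spec.sqrt (by norm_num)).bind_eq <| (Spec.div _ (by norm_num)).bind_eq <|
    (tailSq_spec y).bind_eq <| (Spec.sqrt (sum_sq_tail_nonneg y)).bind_eq <|
    (Spec.div _ hy0.ne').bind_eq <| (Spec.comp_le _ _).bind fun b hb =>
    Spec.ite (N₁ := 0) (N₂ := 3 + 3 * p) (fun h => Spec.ret ?_) fun h => ?_) (by omega)
  · exact_mod_cast cutVectors_axis hy (by exact_mod_cast hb.1 h)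
  · have hη : 3 / 5 < tailNorm y / y 0 := not_le.1 fun h' => h (hb.2 (by exact_mod_cast h'))
    have hη0 : √(∑ a : Fin p, y a.succ ^ 2) / y 0 ≠ 0 :=
      (lt_trans (by norm_num) hη).ne'
    refine Spec.le ((Spec.mul _ _).bind_eq <| (Spec.sub _ _).bind_eq <|
      (Spec.div _ (mul_ne_zero hη0 hη0)).bind_eq <|
      (Spec.fill_fin _ fun a => (Spec.div _ hy0.ne').bind_eq <| Spec.mul _ _).bind_eq <|
      (Spec.fill_fin _ fun a => Spec.sub _ _).bind_eq <| Spec.ret ?_) (by omega)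
    exact_mod_cast cutVectors_oblique hy rfl hη rfl rfl

/-- The automorphism with parameters `c`, `α`, `β` is the one that belongs to a cut with cut
generating block `y`. -/
structure CutBoost (y : Fin (p + 1) → ℝ) (c α : ℝ) (β : Fin p → ℝ) : Prop where
  factor_pos : 0 < c
  factor_le : c ≤ 0.96
  head_pos : 0 < α
  unit : α ^ 2 - ∑ a, β a ^ 2 = 1
  inv_head_le : ∀ x, x 0 ≤ 1 → y ⬝ᵥ x ≤ y 0 * (1 / √2) →
    (boost c⁻¹ α (-β)).mulVec x 0 ≤ 1
  inv_head_lt : ∀ x, x 0 ≤ 1 → y ⬝ᵥ x < y 0 * (1 / √2) →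
    (boost c⁻¹ α (-β)).mulVec x 0 < 1

/-- The head of `G⁻¹x` is `wᵀx / wᵀv`, so the combination in `CutVectors.comb` bounds it by 1. Its
positive weight `b` on the `y`-inequality transmits strictness. -/
theorem CutVectors.cutBoost {y w v : Fin (p + 1) → ℝ} (h : CutVectors y w v) :
    CutBoost y (w 0 / √(lorentz w) * v 0 + (fun a : Fin p => w a.succ / √(lorentz w)) ⬝ᵥ
      fun a => v a.succ) (w 0 / √(lorentz w)) (fun a => w a.succ / √(lorentz w)) := by
  have hg : 0 < √(lorentz w) := Real.sqrt_pos.2 h.lorentz_pos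
  have hgg : √(lorentz w) ^ 2 = lorentz w := Real.sq_sqrt h.lorentz_pos.le
  set g := √(lorentz w)
  have hdot : ∀ x : Fin (p + 1) → ℝ, w 0 / g * x 0 +
      ((fun a : Fin p => w a.succ / g) ⬝ᵥ fun a => x a.succ) = (w ⬝ᵥ x) / g := fun x => by
    rw [dotProduct_eq_head_add, dotProduct, add_div, Finset.sum_div]
    congr 1
    · ring
    · exact Finset.sum_congr rfl fun _ _ => by ring
  have hinv : ∀ x : Fin (p + 1) → ℝ, (boost ((w ⬝ᵥ v) / g)⁻¹ (w 0 / g)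
      (-fun a : Fin p => w a.succ / g)).mulVec x 0 = (w ⬝ᵥ x) / (w ⬝ᵥ v) := fun x => by
    have := h.dot_pos.ne'
    rw [boost_mulVec, Fin.cons_zero, neg_dotProduct, sub_neg_eq_add, hdot]
    field_simp
  rw [hdot]
  obtain ⟨a, b, ha, hb, hv, hx⟩ := h.comb
  refine ⟨div_pos h.dot_pos hg, ?_, div_pos h.head_pos hg, ?_, fun x hx0 hyx => ?_,
    fun x hx0 hyx => ?_⟩
  · rw [div_le_iff₀ hg]
    refine (abs_le_of_sq_le_sq' ?_ (by positivity)).2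
    rw [mul_pow, hgg]
    exact h.dot_sq_le
  · simp only [div_pow, ← Finset.sum_div, ← sub_div]
    rw [hgg]
    exact div_self h.lorentz_pos.ne'
  · rw [hinv, div_le_one h.dot_pos, hv, hx]
    nlinarith
  · rw [hinv, div_lt_one h.dot_pos, hv, hx]
    nlinarith

theorem autParams_spec {y w v : Fin (p + 1) → ℝ} (h : CutVectors y w v) :
    Spec (autParams w v) (fun g => CutBoost y g.1 g.2.1 g.2.2) (9 * (p + 1)) := by
  have hl : w 0 * w 0 - ∑ a : Fin p, w a.succ ^ 2 = lorentz w := by rw [lorentz, pow_two (w 0)]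
  have hl0 : 0 ≤ w 0 * w 0 - ∑ a : Fin p, w a.succ ^ 2 := hl ▸ h.lorentz_pos.le
  have hg : √(w 0 * w 0 - ∑ a : Fin p, w a.succ ^ 2) ≠ 0 := by
    rw [hl]; exact (Real.sqrt_pos.2 h.lorentz_pos).ne'
  refine Spec.le (Spec.lit_zero.bind_eq <| (Spec.mul _ _).bind_eq <| (tailSq_spec w).bind_eq <|
    (Spec.sub _ _).bind_eq <| (Spec.sqrt hl0).bind_eq <| (Spec.div _ hg).bind_eq <|
    (Spec.fill_fin _ fun a => Spec.div _ hg).bind_eq <| (Spec.mul _ _).bind_eq <|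
    (Spec.dot_fin _ _).bind_eq <| (Spec.add _ _).bind_eq <| Spec.ret ?_) (by omega)
  dsimp only
  rw [hl]
  exact h.cutBoost

end Rescaling

/-! ### Invariants of the scaled problem and correctness of the outputs. -/

section MainAlgorithm

variable {n m : ℕ} {r : Fin n → ℕ}

/-- Multiplication by a block-diagonal matrix. -/
def blockMap (B : (i : Fin n) → Matrix (Fin (r i + 1)) (Fin (r i + 1)) ℝ) :
    (Idx r → ℝ) →ₗ[ℝ] (Idx r → ℝ) where
  toFun x q := (B q.1).mulVec (blk x q.1) q.2
  map_add' x y := funext fun q => congrFun ((B q.1).mulVec_add (blk x q.1) (blk y q.1)) q.2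
  map_smul' c x := funext fun q => congrFun ((B q.1).mulVec_smul c (blk x q.1)) q.2

theorem blk_blockMap (B : (i : Fin n) → Matrix (Fin (r i + 1)) (Fin (r i + 1)) ℝ)
    (x : Idx r → ℝ) (i : Fin n) : blk (blockMap B x) i = (B i).mulVec (blk x i) := rfl

theorem blk_ext {x y : Idx r → ℝ} (h : ∀ i, blk x i = blk y i) : x = y :=
  funext fun q => congrFun (h q.1) q.2

theorem blockMap_transpose_dotProduct
    (B : (i : Fin n) → Matrix (Fin (r i + 1)) (Fin (r i + 1)) ℝ) (x y : Idx r → ℝ) :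
    blockMap (fun i => (B i).transpose) x ⬝ᵥ y = x ⬝ᵥ blockMap B y := by
  rw [dotProduct_eq_sum_blk, dotProduct_eq_sum_blk]
  refine Finset.sum_congr rfl fun i _ => ?_
  rw [blk_blockMap, blk_blockMap, Matrix.dotProduct_mulVec, Matrix.mulVec_transpose]

theorem mulBlocks_spec {d : ℕ} (hd : ∀ i, r i + 1 ≤ d)
    (B : (i : Fin n) → Fin (r i + 1) → Fin (r i + 1) → ℝ) (x : Idx r → ℝ) :
    Spec (mulBlocks B x) (· = blockMap (fun i => Matrix.of (B i)) x)
      (1 + (∑ i, (r i + 1)) * (1 + d * 2)) := by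
  refine Spec.lit_zero.bind_eq (Spec.fill_idx _ fun q => Spec.le (Spec.dot_fin _ _) ?_)
  have := hd q.1
  omega

/-- The state of the main algorithm for the data `A`; block `i` has been scaled by the factor
`γ i`. -/
structure MainState.IsScaled (A : Matrix (Fin m) (Idx r) ℝ) (γ : Fin n → ℝ)
    (s : MainState ℝ m r) : Prop where
  scaling : ∀ i, BlockScaling (γ i) (Matrix.of (s.M i)) (Matrix.of (s.L i))
  rows : ∀ j, s.A j = blockMap (fun i => (Matrix.of (s.M i)).transpose) (A j)
  det : ∀ i, s.v i = γ i ^ (r i + 1)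
  head_le : ∀ x ∈ feasibleSet A, ∀ i,
    (Matrix.of (s.L i)).transpose.mulVec (blk x i) 0 ≤ 1

namespace MainState.IsScaled

variable {A : Matrix (Fin m) (Idx r) ℝ} {γ : Fin n → ℝ} {s : MainState ℝ m r}

theorem blockMap_dual_row (h : s.IsScaled A γ) (j : Fin m) :
    blockMap (fun i => Matrix.of (s.L i)) (s.A j) = A j := by
  rw [h.rows]
  refine blk_ext fun i => ?_
  rw [blk_blockMap, blk_blockMap, Matrix.mulVec_mulVec, ← Matrix.transpose_transpose
    (Matrix.of (s.L i)), ← Matrix.transpose_mul, (h.scaling i).mul_transpose,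
    Matrix.transpose_one, Matrix.one_mulVec]

theorem linearIndependent (h : s.IsScaled A γ) (hA : LinearIndependent ℝ fun j => A j) :
    LinearIndependent ℝ s.A := by
  refine LinearIndependent.of_comp (blockMap fun i => Matrix.of (s.L i)) ?_
  have : (blockMap fun i => Matrix.of (s.L i)) ∘ s.A = fun j => A j :=
    funext h.blockMap_dual_row
  rwa [this]

theorem row_dotProduct (h : s.IsScaled A γ) (j : Fin m) (x : Idx r → ℝ) :
    s.A j ⬝ᵥ x = A.mulVec (blockMap (fun i => Matrix.of (s.M i)) x) j := by
  rw [h.rows, blockMap_transpose_dotProduct]; rfl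

theorem blockMap_inverse (h : s.IsScaled A γ) (x : Idx r → ℝ) :
    blockMap (fun i => Matrix.of (s.M i))
      (blockMap (fun i => (Matrix.of (s.L i)).transpose) x) = x :=
  blk_ext fun i => (h.scaling i).mulVec_transpose_mulVec (blk x i)

/-- In scaled coordinates a solution `x` becomes `M⁻¹x = Lᵀx`, which lies in the kernel of `A M`. -/
theorem span_dotProduct_eq_zero (h : s.IsScaled A γ) {x : Idx r → ℝ} (hx : A.mulVec x = 0) :
    ∀ t ∈ Submodule.span ℝ (Set.range s.A),
      t ⬝ᵥ blockMap (fun i => (Matrix.of (s.L i)).transpose) x = 0 := by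
  intro t ht
  induction ht using Submodule.span_induction with
  | mem t ht =>
    obtain ⟨j, rfl⟩ := ht
    rw [h.row_dotProduct, h.blockMap_inverse, hx]; rfl
  | zero => exact zero_dotProduct _
  | add a b _ _ ha hb => rw [add_dotProduct, ha, hb, add_zero]
  | smul c a _ ha => rw [smul_dotProduct, ha, smul_zero]

theorem region_eq (h : s.IsScaled A γ) (i : Fin n) :
    s.region i = {x | x ∈ soc (r i) ∧ (Matrix.of (s.L i)).transpose.mulVec x 0 ≤ 1} :=
  (h.scaling i).image_eq

theorem encloses (h : s.IsScaled A γ) : s.Encloses A := by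
  intro i
  have hγ := (h.scaling i).pos.ne'
  have haxis : tailNorm (axis (r i)) < axis (r i) 0 := by
    rw [tailNorm_axis]; simp [axis]
  refine ⟨?_, (Matrix.of (s.L i)).mulVec (axis (r i)), mem_interior_soc ?_,
    (Matrix.of (s.M i)).mulVec (axis (r i)), mem_interior_soc ?_,
    (h.scaling i).image_eq_truncCone⟩
  · rw [h.region_eq]
    rintro _ ⟨x, hx, rfl⟩
    have hxK : x ∈ prodCone r := hx.2.2
    exact ⟨hxK i, h.head_le x hx i⟩
  · exact (h.scaling i).scales_dual.mulVec_interior (inv_ne_zero hγ) haxis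
  · exact (h.scaling i).scales.mulVec_interior hγ haxis

theorem primal_correct (h : s.IsScaled A γ) {x : Idx r → ℝ} (ε : ℝ)
    (hx : BPOut.Correct (Submodule.span ℝ (Set.range s.A)) (.primal x)) :
    (MainOut.primal (blockMap (fun i => Matrix.of (s.M i)) x)).Correct A ε := by
  obtain ⟨hxV, hxint⟩ := hx
  refine ⟨funext fun j => ?_, mem_interior_prodCone fun i => ?_⟩
  · rw [← h.row_dotProduct]
    exact hxV _ (Submodule.subset_span ⟨j, rfl⟩)
  · rw [blk_blockMap]
    exact (h.scaling i).scales.mulVec_interior (h.scaling i).pos.ne' (hxint i)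

/-- `L = M⁻ᵀ` carries the rows of `A M` back to those of `A`, with the same coefficients; it
preserves the cone and is injective. -/
theorem dual_correct (h : s.IsScaled A γ) {y : Idx r → ℝ} (ε : ℝ)
    (hy : BPOut.Correct (Submodule.span ℝ (Set.range s.A)) (.dual y)) :
    (MainOut.dual (blockMap (fun i => Matrix.of (s.L i)) y)).Correct A ε := by
  obtain ⟨hyV, hyK, hy0⟩ := hy
  refine ⟨?_, fun i => ?_, fun h0 => hy0 ?_⟩
  · obtain ⟨u, rfl⟩ := (Submodule.mem_span_range_iff_exists_fun ℝ).1 hyV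
    refine ⟨-u, ?_⟩
    rw [map_sum, Matrix.mulVec_neg, neg_neg, Matrix.mulVec_transpose]
    simp only [map_smul, h.blockMap_dual_row]
    funext q
    simp [Matrix.vecMul, dotProduct]
  · rw [blk_blockMap]
    exact (h.scaling i).scales_dual.mulVec_mem (hyK i)
  · refine blk_ext fun i => ?_
    have h1 : (Matrix.of (s.L i)).mulVec (blk y i) = 0 := by
      rw [← blk_blockMap (fun i => Matrix.of (s.L i)), h0]; rfl
    have h2 : (Matrix.of (s.M i)).transpose * Matrix.of (s.L i) = 1 := by
      rw [← Matrix.transpose_transpose (Matrix.of (s.L i)), ← Matrix.transpose_mul,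
        (h.scaling i).transpose_mul, Matrix.transpose_one]
    have h3 := congrArg (Matrix.of (s.M i)).transpose.mulVec h1
    rw [Matrix.mulVec_mulVec, h2, Matrix.one_mulVec, Matrix.mulVec_zero] at h3
    rw [h3]; rfl

end MainState.IsScaled

/-! ### The cut inequality for feasible points. -/

theorem dotProduct_self_le_of_head_le {u : Idx r → ℝ} (hu : u ∈ prodCone r)
    (hu1 : ∀ i, blk u i 0 ≤ 1) : u ⬝ᵥ u ≤ 2 * n := by
  rw [dotProduct_eq_sum_blk]
  calc ∑ i, blk u i ⬝ᵥ blk u i ≤ ∑ _i : Fin n, (2 : ℝ) := Finset.sum_le_sum fun i _ => ?_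
    _ = 2 * n := by simp [mul_comm]
  have h1 := mem_soc_iff.1 (hu i)
  have h2 := hu1 i
  rw [lorentz] at h1
  rw [dotProduct_eq_head_add]
  simp only [← pow_two]
  nlinarith

/-- The strict form for interior points is needed because the stopping test `v_k ≤ ε ^ d_k` admits
equality. -/
theorem dotProduct_self_lt_of_head_le (hn : 0 < n) {u : Idx r → ℝ}
    (hu : ∀ i, tailNorm (blk u i) < blk u i 0) (hu1 : ∀ i, blk u i 0 ≤ 1) :
    u ⬝ᵥ u < 2 * n := by
  rw [dotProduct_eq_sum_blk]
  calc ∑ i, blk u i ⬝ᵥ blk u i < ∑ _i : Fin n, (2 : ℝ) :=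
        Finset.sum_lt_sum_of_nonempty ⟨⟨0, hn⟩, Finset.mem_univ _⟩ fun i _ => ?_
    _ = 2 * n := by simp [mul_comm]
  have h1 := tailNorm_lt_iff.1 (hu i)
  have h2 := hu1 i
  rw [lorentz] at h1
  rw [dotProduct_eq_head_add]
  simp only [← pow_two]
  nlinarith

theorem block_dotProduct_le {y u : Idx r → ℝ} (hy : y ∈ prodCone r) (hu : u ∈ prodCone r)
    (k : Fin n) : blk y k ⬝ᵥ blk u k ≤ y ⬝ᵥ u := by
  rw [dotProduct_eq_sum_blk]
  exact Finset.single_le_sum (f := fun i => blk y i ⬝ᵥ blk u i)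
    (fun i _ => dotProduct_nonneg_of_mem_soc (hy i) (hu i)) (Finset.mem_univ k)

theorem dotProduct_sq_le (z u : Idx r → ℝ) : (z ⬝ᵥ u) ^ 2 ≤ (z ⬝ᵥ z) * (u ⬝ᵥ u) := by
  have := Finset.sum_mul_sq_le_sq_mul_sq Finset.univ z u
  simpa only [dotProduct, ← pow_two] using this

theorem four_mul_le_sq {a zz : ℝ} (hzz : 0 < zz) (ha : 2 * √n * √zz ≤ a) :
    0 ≤ a ∧ 4 * n * zz ≤ a ^ 2 := by
  have h0 : 0 ≤ 2 * √(n : ℝ) * √zz := by positivity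
  refine ⟨h0.trans ha, ?_⟩
  have := pow_le_pow_left₀ h0 ha 2
  rw [mul_pow, mul_pow, Real.sq_sqrt (Nat.cast_nonneg n), Real.sq_sqrt hzz.le] at this
  linarith

/-- The other blocks contribute nonnegatively to `yᵀu = zᵀu`. Then Cauchy–Schwarz with `‖u‖² ≤ 2n`
and `4n ‖z‖² ≤ y_{k0}²` gives `(zᵀu)² ≤ y_{k0}²/2`. -/
theorem cut_dotProduct_le {y z u : Idx r → ℝ} {k : Fin n} (hy : y ∈ prodCone r)
    (hu : u ∈ prodCone r) (hu1 : ∀ i, blk u i 0 ≤ 1) (hz : 0 < z ⬝ᵥ z)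
    (hzk : 2 * √n * √(z ⬝ᵥ z) ≤ blk y k 0) (hyz : y ⬝ᵥ u = z ⬝ᵥ u) :
    blk y k ⬝ᵥ blk u k ≤ blk y k 0 * (1 / √2) := by
  obtain ⟨h0, h1, -, -⟩ := inv_sqrt_two_bounds
  obtain ⟨ha, ha2⟩ := four_mul_le_sq hz hzk
  refine (block_dotProduct_le hy hu k).trans ?_
  rw [hyz]
  refine (abs_le_of_sq_le_sq' ?_ (by positivity)).2
  rw [mul_pow, h1]
  have := dotProduct_sq_le z u
  have := dotProduct_self_le_of_head_le hu hu1
  nlinarith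

theorem cut_dotProduct_lt (hn : 0 < n) {y z u : Idx r → ℝ} {k : Fin n} (hy : y ∈ prodCone r)
    (hu : ∀ i, tailNorm (blk u i) < blk u i 0) (hu1 : ∀ i, blk u i 0 ≤ 1) (hz : 0 < z ⬝ᵥ z)
    (hzk : 2 * √n * √(z ⬝ᵥ z) ≤ blk y k 0) (hyz : y ⬝ᵥ u = z ⬝ᵥ u) :
    blk y k ⬝ᵥ blk u k < blk y k 0 * (1 / √2) := by
  obtain ⟨h0, h1, -, -⟩ := inv_sqrt_two_bounds
  obtain ⟨ha, ha2⟩ := four_mul_le_sq hz hzk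
  refine (block_dotProduct_le hy (fun i => (hu i).le) k).trans_lt ?_
  rw [hyz]
  refine (abs_lt_of_sq_lt_sq' ?_ (by positivity)).2
  rw [mul_pow, h1]
  have := dotProduct_sq_le z u
  have := dotProduct_self_lt_of_head_le hn hu hu1
  nlinarith

/-- The state after the scaling of block `k` by the automorphism with parameters `c`, `α`, `β`. -/
noncomputable def MainState.scaleBlock (s : MainState ℝ m r) (k : Fin n) (c α : ℝ)
    (β : Fin (r k) → ℝ) : MainState ℝ m r where
  A := fun j => setBlk (s.A j) k ((boost c α β).mulVec (blk (s.A j) k))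
  M := Function.update s.M k fun a => (boost c α β).mulVec (s.M k a)
  L := Function.update s.L k fun a => (boost c⁻¹ α (-β)).mulVec (s.L k a)
  v := Function.update s.v k (s.v k * c ^ (r k + 1))

theorem rescale_spec (s : MainState ℝ m r) {y : Idx r → ℝ} {k : Fin n}
    (hy : tailNorm (blk y k) < blk y k 0) :
    Spec (rescale s y k)
      (fun s' => ∃ c α β, CutBoost (blk y k) c α β ∧ s' = s.scaleBlock k c α β)
      (30 * (r k + 1) + m * (7 * (r k + 1)) + 14 * (r k + 1) ^ 2) := by
  refine Spec.le ((cutPair_spec hy).bind fun wv hwv =>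
    (autParams_spec hwv).bind (N₂ := 3 + r k + m * (7 * (r k + 1)) + 14 * (r k + 1) ^ 2 +
      (r k + 1)) fun g hg => ?_) (by omega)
  obtain ⟨c, α, β⟩ := g
  dsimp only at hg ⊢
  have hβ : (fun a => 0 - β a) = -β := by funext a; simp
  refine Spec.le (Spec.lit_zero.bind_eq <| Spec.lit_one.bind_eq <|
    (Spec.div _ hg.factor_pos.ne').bind_eq <| (Spec.fill_fin _ fun a => Spec.sub 0 (β a)).bind_eq <|
    (Spec.fill_fin (g := fun j => setBlk (s.A j) k ((boost c α β).mulVec (blk (s.A j) k))) _ fun j =>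
      (applyAut_spec c hg.head_pos β _).bind_eq <| Spec.ret (Q := (· = _)) rfl).bind_eq <|
    (Spec.fill_fin _ fun a => applyAut_spec c hg.head_pos β _).bind_eq <|
    (Spec.fill_fin _ fun a => applyAut_spec (1 / c) hg.head_pos _ _).bind_eq <|
    (Spec.mulPow _ _ _).bind_eq <| Spec.ret ⟨c, α, β, hg, ?_⟩) ?_
  · rw [hβ, one_div]; rfl
  · have : (r k + 1) * (7 * (r k + 1)) = 7 * (r k + 1) ^ 2 := by ring
    rw [this, Nat.add_zero (7 * (r k + 1))]; omega

/-- By symmetry of the automorphism, applying it to every row is multiplication from the right. -/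
theorem of_boost_rows {p : ℕ} (c α : ℝ) (β : Fin p → ℝ) (N : Fin (p + 1) → Fin (p + 1) → ℝ) :
    (Matrix.of fun a => (boost c α β).mulVec (N a)) = Matrix.of N * boost c α β := by
  funext a
  rw [Matrix.mul_apply_eq_vecMul, ← Matrix.mulVec_transpose, boost_transpose]
  rfl

section ScaleBlock

variable {A : Matrix (Fin m) (Idx r) ℝ} {γ : Fin n → ℝ} {s : MainState ℝ m r} {k : Fin n}
  {c α : ℝ} {β : Fin (r k) → ℝ}

theorem of_scaleBlock_M_self :
    Matrix.of ((s.scaleBlock k c α β).M k) = Matrix.of (s.M k) * boost c α β := by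
  rw [← of_boost_rows]
  simp [MainState.scaleBlock]

theorem of_scaleBlock_L_self :
    Matrix.of ((s.scaleBlock k c α β).L k) = Matrix.of (s.L k) * boost c⁻¹ α (-β) := by
  rw [← of_boost_rows]
  simp [MainState.scaleBlock]

theorem scaleBlock_M_of_ne {i : Fin n} (h : i ≠ k) : (s.scaleBlock k c α β).M i = s.M i := by
  simp [MainState.scaleBlock, h]

theorem scaleBlock_L_of_ne {i : Fin n} (h : i ≠ k) : (s.scaleBlock k c α β).L i = s.L i := by
  simp [MainState.scaleBlock, h]

/-- The result of a cut of block `k` by the factor `c`. -/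
structure MainState.CutStep (A : Matrix (Fin m) (Idx r) ℝ) (γ : Fin n → ℝ)
    (s s' : MainState ℝ m r) (k : Fin n) (c : ℝ) : Prop where
  factor_pos : 0 < c
  factor_le : c ≤ 0.96
  isScaled : s'.IsScaled A (Function.update γ k (γ k * c))
  volume_le : MeasureTheory.volume (s'.region k) ≤
    ENNReal.ofReal ((0.96 : ℝ) ^ (r k + 1)) * MeasureTheory.volume (s.region k)
  region_eq : ∀ i, i ≠ k → s'.region i = s.region i
  head_lt : ∀ x ∈ feasibleSet A, (∀ i, tailNorm (blk x i) < blk x i 0) →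
    (Matrix.of (s'.L k)).transpose.mulVec (blk x k) 0 < 1

theorem MainState.IsScaled.cutStep (h : s.IsScaled A γ) {y : Idx r → ℝ}
    (hy : BPOut.Correct (Submodule.span ℝ (Set.range s.A)) (.cut y k))
    (hc : CutBoost (blk y k) c α β) :
    MainState.CutStep A γ s (s.scaleBlock k c α β) k c := by
  obtain ⟨hyint, z, hz, hzk, hyz⟩ := hy
  have hn : 0 < n := k.pos
  have hyK : y ∈ prodCone r := fun i => (hyint i).le
  have hLk : ∀ x : Idx r → ℝ,
      (Matrix.of ((s.scaleBlock k c α β).L k)).transpose.mulVec (blk x k) =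
        (boost c⁻¹ α (-β)).mulVec ((Matrix.of (s.L k)).transpose.mulVec (blk x k)) := fun x => by
    rw [of_scaleBlock_L_self, Matrix.transpose_mul, boost_transpose, Matrix.mulVec_mulVec]
  have hu : ∀ (x : Idx r → ℝ) (i : Fin n),
      blk (blockMap (fun i => (Matrix.of (s.L i)).transpose) x) i =
      (Matrix.of (s.L i)).transpose.mulVec (blk x i) := fun x i => blk_blockMap _ x i
  have hle : ∀ x ∈ feasibleSet A, blk y k ⬝ᵥ (Matrix.of (s.L k)).transpose.mulVec (blk x k) ≤
      blk y k 0 * (1 / √2) := fun x hx => by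
    have hxK : x ∈ prodCone r := hx.2.2
    rw [← hu]
    refine cut_dotProduct_le hyK (fun i => ?_) (fun i => ?_) hz hzk
      (hyz _ (h.span_dotProduct_eq_zero hx.1))
    · rw [hu]; exact (h.scaling i).scales_dual_transpose.mulVec_mem (hxK i)
    · rw [hu]; exact h.head_le x hx i
  have hlt : ∀ x ∈ feasibleSet A, (∀ i, tailNorm (blk x i) < blk x i 0) →
      blk y k ⬝ᵥ (Matrix.of (s.L k)).transpose.mulVec (blk x k) <
        blk y k 0 * (1 / √2) := fun x hx hxint => by
    rw [← hu]
    refine cut_dotProduct_lt hn hyK (fun i => ?_) (fun i => ?_) hz hzk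
      (hyz _ (h.span_dotProduct_eq_zero hx.1))
    · rw [hu]
      exact (h.scaling i).scales_dual_transpose.mulVec_interior
        (inv_ne_zero (h.scaling i).pos.ne') (hxint i)
    · rw [hu]; exact h.head_le x hx i
  refine ⟨hc.factor_pos, hc.factor_le, ⟨fun i => ?_, fun j => ?_, fun i => ?_,
    fun x hx i => ?_⟩, ?_, fun i hi => ?_, fun x hx hxint => ?_⟩
  · by_cases hi : i = k
    · subst hi
      rw [of_scaleBlock_M_self, of_scaleBlock_L_self, Function.update_self]
      exact (h.scaling i).mul_boost hc.factor_pos hc.head_pos hc.unit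
    · rw [scaleBlock_M_of_ne hi, scaleBlock_L_of_ne hi, Function.update_of_ne hi]
      exact h.scaling i
  · refine blk_ext fun i => ?_
    rw [blk_blockMap]
    by_cases hi : i = k
    · subst hi
      rw [of_scaleBlock_M_self, Matrix.transpose_mul, boost_transpose, ← Matrix.mulVec_mulVec]
      refine (blk_setBlk_self _ _ _).trans ?_
      rw [h.rows, blk_blockMap]
    · rw [scaleBlock_M_of_ne hi]
      refine (blk_setBlk_of_ne _ hi _).trans ?_
      rw [h.rows, blk_blockMap]
  · by_cases hi : i = k
    · subst hi
      simp [MainState.scaleBlock, h.det, mul_pow]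
    · simp [MainState.scaleBlock, h.det, hi]
  · by_cases hi : i = k
    · subst hi
      rw [hLk]
      exact hc.inv_head_le _ (h.head_le x hx i) (hle x hx)
    · rw [scaleBlock_L_of_ne hi]
      exact h.head_le x hx i
  · unfold MainState.region
    rw [of_scaleBlock_M_self]
    exact volume_image_mul_boost _ hc.factor_pos.le hc.factor_le hc.head_pos hc.unit _
  · unfold MainState.region
    rw [scaleBlock_M_of_ne hi]
  · rw [hLk]
    exact hc.inv_head_lt _ (h.head_le x hx k) (hlt x hx hxint)

/-- For a point with minimum eigenvalue at least `ε`, `x₀² - ‖x₁‖² = (x₀ - ‖x₁‖)(x₀ + ‖x₁‖) ≥ ε²` in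
block `k`. The scaled block has head, hence form, below 1, so the same quantity is below `(γ_k c)² ≤
ε²`. -/
theorem MainState.CutStep.noInterior_correct {s' : MainState ℝ m r} {ε : ℝ}
    (h : MainState.CutStep A γ s s' k c) (hε : 0 < ε) (hle : γ k * c ≤ ε) :
    (MainOut.noInterior (r := r)).Correct A ε := by
  rintro ⟨x, hAx, hx1, hx⟩
  have hlam : ∀ i, ε ≤ blk x i 0 - tailNorm (blk x i) := fun i =>
    hx.trans (ciInf_le (Set.finite_range _).bddBelow i)
  have hint : ∀ i, tailNorm (blk x i) < blk x i 0 := fun i => by linarith [hlam i]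
  have hfeas : x ∈ feasibleSet A := ⟨hAx, hx1, fun i => (hint i).le⟩
  have hs := h.isScaled.scaling k
  rw [Function.update_self] at hs
  have h1 := h.head_lt x hfeas hint
  have h2 := hs.scales_dual_transpose.form (blk x k)
  have h3 := hs.scales_dual_transpose.mulVec_mem (hint k).le
  set u := (Matrix.of (s'.L k)).transpose.mulVec (blk x k)
  have h4 : lorentz u < 1 := by
    have := sum_sq_tail_nonneg u
    have := (mem_soc_iff.1 h3).1
    rw [lorentz]; nlinarith
  have h5 : ε ^ 2 ≤ lorentz (blk x k) := by
    have := hlam k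
    have := tailNorm_nonneg (blk x k)
    rw [lorentz_eq]; nlinarith
  have h6 : lorentz (blk x k) = (γ k * c) ^ 2 * lorentz u := by
    have := hs.pos.ne'
    rw [h2, ← mul_assoc, ← mul_pow, mul_inv_cancel₀ this, one_pow, one_mul]
  have h7 : 0 < (γ k * c) ^ 2 := by have := hs.pos; positivity
  have h8 : (γ k * c) ^ 2 ≤ ε ^ 2 := pow_le_pow_left₀ hs.pos.le hle 2
  nlinarith

end ScaleBlock

end MainAlgorithm

/-! ### Counting passes and operations. -/

section MainTheorem

variable {n m : ℕ} {r : Fin n → ℕ}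

theorem mainInit_spec (A : Matrix (Fin m) (Idx r) ℝ) :
    Spec (mainInit fun j => A j) (fun s => s.IsScaled A fun _ => 1) 2 := by
  refine Spec.le (Spec.lit_zero.bind_eq <| Spec.lit_one.bind_eq <| Spec.ret ?_) le_rfl
  have hone : ∀ i : Fin n,
      (Matrix.of fun a b : Fin (r i + 1) => if a = b then (1 : ℝ) else 0) = 1 := fun i => by
    ext a b; rw [Matrix.of_apply, Matrix.one_apply]
  refine ⟨fun i => ?_, fun j => blk_ext fun i => ?_, fun i => (one_pow _).symm, fun x hx i => ?_⟩
  · dsimp only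
    rw [hone]
    exact BlockScaling.one
  · rw [blk_blockMap]
    dsimp only
    rw [hone, Matrix.transpose_one, Matrix.one_mulVec]
  · dsimp only
    rw [hone, Matrix.transpose_one, Matrix.one_mulVec]
    have hx1 : ‖x‖ ≤ 1 := hx.2.1
    exact (le_abs_self _).trans ((norm_le_pi_norm x ⟨i, 0⟩).trans hx1)

/-- Admissible starting points of the basic procedure. -/
structure IsStart (y : Idx r → ℝ) : Prop where
  interior : ∀ i, tailNorm (blk y i) < blk y i 0
  sum_eq : ∑ i, blk y i 0 = 1

theorem startVec_spec (hn : 0 < n) (r : Fin n → ℕ) : Spec (startVec r) IsStart 4 := by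
  have hn' : (0 : ℝ) < n := by exact_mod_cast hn
  refine Spec.le (Spec.lit_zero.bind_eq <| Spec.lit_one.bind_eq <| (Spec.lit n).bind_eq <|
    (Spec.div 1 hn'.ne').bind_eq <| Spec.ret ⟨fun i => ?_, ?_⟩) le_rfl
  · simp [blk, tailNorm, hn]
  · simp [blk, hn'.ne']

theorem mainIter_spec (hn : 0 < n) {d : ℕ} (hd : ∀ i, r i + 1 ≤ d)
    {A : Matrix (Fin m) (Idx r) ℝ} (hA : LinearIndependent ℝ fun j => A j) {γ : Fin n → ℝ}
    {s : MainState ℝ m r} (hs : s.IsScaled A γ) {y₀ : Idx r → ℝ} (hy₀ : IsStart y₀) (ε : ℝ) :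
    Spec (mainIter y₀ s) (Sum.elim (fun out => out.Correct A ε)
        fun sk => ∃ c, MainState.CutStep A γ s sk.1 sk.2 c)
      (600 * (n ^ 3 * ((∑ i, (r i + 1)) * d) + m * (∑ i, (r i + 1)) ^ 2)) 1 := by
  have hN1 := one_le_sum_dims hn r
  have hrN : ∀ k, r k + 1 ≤ ∑ i, (r i + 1) := fun k =>
    Finset.single_le_sum (f := fun i => r i + 1) (fun _ _ => Nat.zero_le _) (Finset.mem_univ k)
  have hbp := basicProcedure_spec hn hd (hs.linearIndependent hA) hy₀.interior hy₀.sum_eq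
  have hMB := fun x => mulBlocks_spec hd s.M x
  have hLB := fun x => mulBlocks_spec hd s.L x
  generalize ∑ i, (r i + 1) = N at *
  have hd1 : 1 ≤ d := (Nat.le_add_left 1 _).trans (hd ⟨0, hn⟩)
  have hX : N * d ≤ n ^ 3 * (N * d) := Nat.le_mul_of_pos_left _ (Nat.one_le_pow _ _ hn)
  have hNd : 1 ≤ N * d := Nat.mul_pos hN1 hd1
  have hmul : 1 + N * (1 + d * 2) ≤ 4 * (N * d) := by nlinarith
  have hresc : ∀ k, 30 * (r k + 1) + m * (7 * (r k + 1)) + 14 * (r k + 1) ^ 2 ≤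
      44 * (N * d) + 7 * (m * N ^ 2) := fun k => by
    have h1 : r k + 1 ≤ N * d := (hrN k).trans (Nat.le_mul_of_pos_right _ hd1)
    have h2 : (r k + 1) ^ 2 ≤ N * d := by
      rw [pow_two]; exact Nat.mul_le_mul (hrN k) (hd k)
    have h3 : m * (7 * (r k + 1)) ≤ 7 * (m * N ^ 2) := by
      calc m * (7 * (r k + 1)) = 7 * (m * (r k + 1)) := by ring
        _ ≤ 7 * (m * N ^ 2) := by
          gcongr; exact (hrN k).trans (Nat.le_self_pow two_ne_zero N)
    omega
  refine Spec.mono (hbp.call.bind_add (N₂ := 44 * (N * d) + 7 * (m * N ^ 2)) (K' := 0)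
    fun out hout => ?_) (fun _ h => h) (by omega) le_rfl
  match out, hout with
  | .primal x, hout =>
    exact Spec.le ((hMB x).bind_eq <| Spec.ret (hs.primal_correct ε hout)) (by omega)
  | .dual y, hout =>
    exact Spec.le ((hLB y).bind_eq <| Spec.ret (hs.dual_correct ε hout)) (by omega)
  | .cut y k, hout =>
    refine Spec.le ((rescale_spec s (hout.1 k)).bind (N₂ := 0) fun s' hs' => Spec.ret ?_) (hresc k)
    obtain ⟨c, α, β, hc, rfl⟩ := hs'
    exact ⟨c, hs.cutStep hout hc⟩

theorem mainBody_spec (hn : 0 < n) {d : ℕ} (hd : ∀ i, r i + 1 ≤ d)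
    {A : Matrix (Fin m) (Idx r) ℝ} (hA : LinearIndependent ℝ fun j => A j) {γ : Fin n → ℝ}
    {s : MainState ℝ m r} (hs : s.IsScaled A γ) {y₀ : Idx r → ℝ} (hy₀ : IsStart y₀) {ε : ℝ}
    (hε : 0 < ε) :
    Spec (mainBody ε y₀ s)
      (Sum.elim (fun s' => ∃ k c, MainState.CutStep A γ s s' k c ∧ ε < γ k * c)
        fun out => out.Correct A ε)
      (603 * (n ^ 3 * ((∑ i, (r i + 1)) * d) + m * (∑ i, (r i + 1)) ^ 2)) 1 := by
  have hN1 := one_le_sum_dims hn r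
  have hd1 : 1 ≤ d := (Nat.le_add_left 1 _).trans (hd ⟨0, hn⟩)
  have hit := mainIter_spec hn hd hA hs hy₀ ε
  generalize ∑ i, (r i + 1) = N at *
  have hdX : d ≤ n ^ 3 * (N * d) :=
    (Nat.le_mul_of_pos_left _ hN1).trans (Nat.le_mul_of_pos_left _ (Nat.one_le_pow _ _ hn))
  refine Spec.mono (hit.bind_add (N₂ := 2 + d) (K' := 0) fun res hres => ?_)
    (fun _ h => h) (by omega) le_rfl
  match res, hres with
  | .inl out, hres => exact Spec.le (Spec.ret hres) (Nat.zero_le _)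
  | .inr (s', k), hres =>
    obtain ⟨c, hc⟩ := hres
    -- Turns the test on `v_k` into a comparison of `γ_k c` with `ε`, by monotonicity of powers.
    have hdet : s'.v k = (γ k * c) ^ (r k + 1) := by
      have := hc.isScaled.det k
      rwa [Function.update_self] at this
    have hpos : 0 < γ k * c := mul_pos (hs.scaling k).pos hc.factor_pos
    refine Spec.le (Spec.lit_one.bind_eq <| (Spec.mulPow 1 ε (r k + 1)).bind_eq <|
      (Spec.comp_le _ _).bind fun b hb => Spec.ite (N₁ := 0) (N₂ := 0)
        (fun h => Spec.ret ?_) fun h => Spec.ret ?_) (by have := hd k; omega)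
    · refine hc.noInterior_correct hε ?_
      have := hb.1 h
      rw [one_mul] at this
      dsimp only at this
      rw [hdet] at this
      exact le_of_pow_le_pow_left₀ (Nat.succ_ne_zero _) hε.le this
    · refine ⟨k, c, hc, not_le.1 fun h' => h (hb.2 ?_)⟩
      rw [one_mul]
      dsimp only
      rw [hdet]
      exact pow_le_pow_left₀ hpos.le h' _

theorem mainAlgorithm_spec (hn : 0 < n) {d : ℕ} (hd : ∀ i, r i + 1 ≤ d)
    {A : Matrix (Fin m) (Idx r) ℝ} (hA : LinearIndependent ℝ fun j => A j) {ε : ℝ}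
    (hε : 0 < ε) {J₀ : ℕ} (hJ₀ : (0.96 : ℝ) ^ J₀ ≤ ε) :
    Spec (mainAlgorithm (fun j => A j) ε) (fun out => out.Correct A ε)
      (6 + (n * J₀ + 1) *
        (603 * (n ^ 3 * ((∑ i, (r i + 1)) * d) + m * (∑ i, (r i + 1)) ^ 2))) (n * J₀ + 1) := by
  refine Spec.le ((startVec_spec hn r).bind fun y₀ hy₀ => (mainInit_spec A).bind
    (N₂ := (n * J₀ + 1) *
      (603 * (n ^ 3 * ((∑ i, (r i + 1)) * d) + m * (∑ i, (r i + 1)) ^ 2)))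
    (K := n * J₀ + 1) fun s hs => ?_) (by omega)
  -- `J i` counts the cuts of block `i`; the variant is `n J₀ - ∑ J i`.
  have := Spec.loop (K := 1) (body := mainBody ε y₀) (Q := fun out => out.Correct A ε)
    (N := 603 * (n ^ 3 * ((∑ i, (r i + 1)) * d) + m * (∑ i, (r i + 1)) ^ 2))
    (Inv := fun κ s => ∃ (γ : Fin n → ℝ) (J : Fin n → ℕ), s.IsScaled A γ ∧
      (∀ i, γ i ≤ 0.96 ^ J i) ∧ (∀ i, J i ≤ J₀) ∧ ∑ i, J i + κ = n * J₀) ?_ (n * J₀) s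
    ⟨fun _ => 1, fun _ => 0, hs, by simp, by simp, by simp⟩
  · rwa [mul_one] at this
  · rintro κ s ⟨γ, J, hs, hγ, hJ, hκ⟩
    refine (mainBody_spec hn hd hA hs hy₀ hε).imp ?_
    rintro (s' | out) hout
    · obtain ⟨k, c, hc, hlt⟩ := hout
      have hγk : γ k * c ≤ 0.96 ^ (J k + 1) := by
        rw [pow_succ]
        exact mul_le_mul (hγ k) hc.factor_le hc.factor_pos.le (by positivity)
      -- The pass continues, so `0.96 ^ J₀ ≤ ε < γ_k c ≤ 0.96 ^ (J k + 1)`.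
      have hJk : J k + 1 ≤ J₀ := by
        by_contra! h
        have : (0.96 : ℝ) ^ (J k + 1) ≤ 0.96 ^ J₀ :=
          pow_le_pow_of_le_one (by norm_num) (by norm_num) h.le
        linarith
      have hJ' : ∀ i, Function.update J k (J k + 1) i ≤ J₀ := fun i => by
        by_cases hi : i = k
        · subst hi; rwa [Function.update_self]
        · rw [Function.update_of_ne hi]; exact hJ i
      have hsum : ∑ i, Function.update J k (J k + 1) i = ∑ i, J i + 1 := by
        rw [Finset.sum_update_of_mem (Finset.mem_univ k),
          ← Finset.add_sum_erase _ J (Finset.mem_univ k), Finset.sdiff_singleton_eq_erase]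
        ring
      have hle : ∑ i, Function.update J k (J k + 1) i ≤ n * J₀ := by
        simpa using Finset.sum_le_sum fun i (_ : i ∈ Finset.univ) => hJ' i
      refine ⟨κ - 1, by omega, Function.update γ k (γ k * c), Function.update J k (J k + 1),
        hc.isScaled, fun i => ?_, hJ', by omega⟩
      by_cases hi : i = k
      · subst hi; rwa [Function.update_self, Function.update_self]
      · rw [Function.update_of_ne hi, Function.update_of_ne hi]; exact hγ i
    · exact hout

theorem Reached.isScaled (hn : 0 < n) {A : Matrix (Fin m) (Idx r) ℝ}
    (hA : LinearIndependent ℝ fun j => A j) {ε : ℝ} (hε : 0 < ε) {y₀ : Idx r → ℝ}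
    (hy₀ : IsStart y₀) {s : MainState ℝ m r} (h : Reached A ε y₀ s) :
    ∃ γ, s.IsScaled A γ := by
  induction h with
  | init h => exact ⟨_, ((mainInit_spec A).2 _ _ h).1⟩
  | step _ h ih =>
    obtain ⟨γ, hγ⟩ := ih
    obtain ⟨k, c, hc, -⟩ := ((mainBody_spec hn (d := Finset.univ.sup fun i => r i + 1)
      (fun i => Finset.le_sup (f := fun i => r i + 1) (Finset.mem_univ i)) hA hγ hy₀ hε).2 _ _ h).1
    exact ⟨_, hc.isScaled⟩

theorem exists_pow_le {ε : ℝ} (hε : 0 < ε) :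
    ∃ J : ℕ, (0.96 : ℝ) ^ J ≤ ε ∧ (J : ℝ) ≤ 26 * max 1 (Real.log ε⁻¹) := by
  have hL : (1 : ℝ) ≤ max 1 (Real.log ε⁻¹) := le_max_left _ _
  have hL' : Real.log ε⁻¹ ≤ max 1 (Real.log ε⁻¹) := le_max_right _ _
  set l := max 1 (Real.log ε⁻¹)
  -- `log 0.96 ≤ -1/25`; the constant 26 absorbs the rounding, as `l ≥ 1`.
  refine ⟨⌈25 * l⌉₊, ?_, ?_⟩
  · rw [← Real.log_le_log_iff (by positivity) hε, Real.log_pow]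
    have h1 : Real.log 0.96 ≤ 0.96 - 1 := Real.log_le_sub_one_of_pos (by norm_num)
    have h2 : 25 * l ≤ ⌈25 * l⌉₊ := Nat.le_ceil _
    rw [Real.log_inv] at hL'
    nlinarith
  · have := Nat.ceil_lt_add_one (show 0 ≤ 25 * l by linarith)
    linarith

end MainTheorem

theorem mainTheorem1 :
    ∃ C : ℝ, 0 < C ∧
      ∀ (n m : ℕ) (r : Fin n → ℕ) (A : Matrix (Fin m) (Idx r) ℝ) (ε : ℝ),
        0 < n → LinearIndependent ℝ (fun j => A j) → 0 < ε →
        (mainAlgorithm (fun j => A j) ε).Halts ∧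
        (∀ (out : MainOut ℝ r) (cost : Prog.Cost),
          (mainAlgorithm (fun j => A j) ε).Runs out cost →
            (cost.2 : ℝ) ≤ C * (n * max 1 (Real.log ε⁻¹)) ∧
            (cost.1 : ℝ) ≤ C * (n *
              ((n : ℝ) ^ 3 * (∑ i, (r i + 1) : ℕ) * (Finset.univ.sup fun i => r i + 1 : ℕ)
                + m * ((∑ i, (r i + 1) : ℕ) : ℝ) ^ 2) * max 1 (Real.log ε⁻¹)) ∧
            out.Correct A ε) ∧
        (∀ (y₀ : Idx r → ℝ) (c₀ : Prog.Cost), (startVec r).Runs y₀ c₀ →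
          ∀ s : MainState ℝ m r, Reached A ε y₀ s →
            s.Encloses A ∧
            ∀ (s' : MainState ℝ m r) (k : Fin n) (c : Prog.Cost),
              (mainIter y₀ s).Runs (Sum.inr (s', k)) c →
                s'.Encloses A ∧
                MeasureTheory.volume (s'.region k) ≤
                  ENNReal.ofReal ((0.96 : ℝ) ^ (r k + 1)) * MeasureTheory.volume (s.region k) ∧
                ∀ i, i ≠ k → s'.region i = s.region i) := by
  -- At most `27 n l` passes of `603 T` operations and 6 initial ones: `27 · 603 + 6 = 16287`.
  refine ⟨20000, by norm_num, fun n m r A ε hn hA hε => ?_⟩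
  have hd : ∀ i, r i + 1 ≤ Finset.univ.sup fun i => r i + 1 := fun i =>
    Finset.le_sup (f := fun i => r i + 1) (Finset.mem_univ i)
  obtain ⟨J, hJ, hJle⟩ := exists_pow_le hε
  have hspec := mainAlgorithm_spec hn hd hA hε hJ
  refine ⟨hspec.1, fun out cost hrun => ?_, fun y₀ c₀ hy₀ s hs => ?_⟩
  · obtain ⟨hout, hc1, hc2⟩ := hspec.2 out cost hrun
    have hN1 := one_le_sum_dims hn r
    have hd1 := (Nat.le_add_left 1 _).trans (hd ⟨0, hn⟩)
    have hL : (1 : ℝ) ≤ max 1 (Real.log ε⁻¹) := le_max_left _ _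
    generalize max 1 (Real.log ε⁻¹) = l at *
    generalize (Finset.univ.sup fun i => r i + 1) = d at *
    generalize ∑ i, (r i + 1) = N at *
    have hn' : (1 : ℝ) ≤ n := by exact_mod_cast hn
    have hpass : (n : ℝ) * J + 1 ≤ 27 * (n * l) := by nlinarith
    have hT : (1 : ℝ) ≤ (n : ℝ) ^ 3 * N * d + m * (N : ℝ) ^ 2 := by
      have : 1 ≤ n ^ 3 * N * d + m * N ^ 2 :=
        Nat.le_add_right_of_le (Nat.mul_pos (Nat.mul_pos (Nat.pow_pos hn) hN1) hd1)
      exact_mod_cast this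
    refine ⟨?_, ?_, hout⟩
    · have : (cost.2 : ℝ) ≤ n * J + 1 := by exact_mod_cast hc2
      nlinarith
    · have h1 : (cost.1 : ℝ) ≤ 6 + (n * J + 1) *
          (603 * ((n : ℝ) ^ 3 * (N * d) + m * (N : ℝ) ^ 2)) := by exact_mod_cast hc1
      rw [← mul_assoc ((n : ℝ) ^ 3)] at h1
      generalize (n : ℝ) ^ 3 * N * d + m * (N : ℝ) ^ 2 = T at *
      have hnl : 1 ≤ (n : ℝ) * l := by nlinarith
      have h2 : ((n : ℝ) * J + 1) * (603 * T) ≤ 27 * (n * l) * (603 * T) := by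
        gcongr
      have h3 : 1 ≤ n * l * T := by nlinarith
      calc (cost.1 : ℝ) ≤ 6 + 27 * (n * l) * (603 * T) := h1.trans (by linarith)
        _ ≤ 20000 * (n * l * T) := by linarith
        _ = 20000 * (n * T * l) := by ring
  · have hstart := ((startVec_spec hn r).2 _ _ hy₀).1
    obtain ⟨γ, hγ⟩ := hs.isScaled hn hA hε hstart
    refine ⟨hγ.encloses, fun s' k c hrun => ?_⟩
    obtain ⟨c', hc'⟩ := ((mainIter_spec hn hd hA hγ hstart ε).2 _ _ hrun).1
    exact ⟨hc'.isScaled.encloses, hc'.volume_le, hc'.region_eq⟩
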